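/- Let $l\ge 1$ be an integer and let $h$ be a holomorphic cusp form of weight $2$ for $\Gamma_0(l)$. Put $H(\tau)=\int_{i\infty}^{\tau}h(s)\,ds$; this also makes sense at rational points $\tau=-\frac dc$ ($c,d\in\mathbb Z$, $c\neq0$) by integrating along the vertical line, and we use the convention $H(-\frac d0)=0$. A weight-$k$ \emph{$h$-twisted cusp form} for $\Gamma_1(l)$ is a holomorphic function $g$ on the upper half plane $\mathcal H$ such that $$g\Big(\frac{a\tau+b}{c\tau+d}\Big)=(c\tau+d)^k\,g(\tau)\,e^{-2\pi i\,\mathrm{Re}\,H(-\frac dc)}\qquad\text{for all }\begin{pmatrix}a&b\\c&d\end{pmatrix}\in\Gamma_1(l),$$ and such that for every $\begin{pmatrix}a&b\\c&d\end{pmatrix}\in SL_2(\mathbb Z)$ the function $g\big(\frac{a\tau+b}{c\tau+d}\big)(c\tau+d)^{-k}$ tends to $0$ as $\tau\to i\infty$ (that is, as $\mathrm{Im}\,\tau\to\infty$, uniformly in $\mathrm{Re}\,\tau$). Let $k\geq 3$ and $j$ be integers. Then the $h$-twisted Eisenstein series $$E_{k,j;h}(\tau)=\sum_{\substack{c\in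 l\mathbb Z,\ d\in\mathbb Z\\ \gcd(l,d)=1,\ (c,d)\ne(0,0)}}(c\tau+d)^{-k}\,e^{-2\pi i\frac{dj}{l}}\,e^{2\pi i\,\mathrm{Re}\,H(-\frac dc)}$$ converges absolutely for every $\tau\in\mathcal H$, and for every weight-$k$ $h$-twisted cusp form $g$ for $\Gamma_1(l)$ one has $$\langle E_{k,j;h},g\rangle=\int_{\Gamma_1(l)\backslash\mathcal H}E_{k,j;h}(\tau)\,\overline{g(\tau)}\,y^{k-2}\,dx\,dy=0,\qquad \tau=x+iy.$$ Here the integral is taken over any fundamental domain for the group of transformations of $\mathcal H$ induced by $\Gamma_1(l)$ (measurability and the tiling property being understood up to null sets); on each such domain it converges absolutely and equals $0$. -/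

import Mathlib

open MeasureTheory UpperHalfPlane CongruenceSubgroup
open scoped MatrixGroups ModularForm Manifold

namespace TwistedModular

/-- `H(z) = ∫_{i∞}^z h(s) ds`, the integral being taken along the vertical line
`s = z + i t`, `t` running from `∞` to `0`. This is used at the cusps `z ∈ ℚ`; the points of the
path lie in the upper half plane. -/
noncomputable def antiderivative (h : ℍ → ℂ) (z : ℂ) : ℂ :=
  -Complex.I * ∫ t in Set.Ioi (0 : ℝ), h (ofComplex (z + t * Complex.I))

/-- The real part of `H(-d/c)`, with the convention `H(-d/0) = H(i∞) = 0`. -/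
noncomputable def reCuspValue (h : ℍ → ℂ) (c d : ℤ) : ℝ :=
  if c = 0 then 0 else (antiderivative h (-((d : ℂ) / (c : ℂ)))).re

/-- `f` is an `h`-twisted modular form of weight `k` for `Γ₁(l)`. -/
structure IsTwistedModularForm (l : ℕ) (h : ℍ → ℂ) (k : ℤ) (f : ℍ → ℂ) : Prop where
  holo : MDifferentiable 𝓘(ℂ) 𝓘(ℂ) f
  map_smul : ∀ γ ∈ Gamma1 l, ∀ τ : ℍ,
    f (γ • τ) = (((γ 1 0 : ℤ) : ℂ) * (τ : ℂ) + ((γ 1 1 : ℤ) : ℂ)) ^ k * f τ *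
      Complex.exp (-(2 * Real.pi * Complex.I * (reCuspValue h (γ 1 0) (γ 1 1) : ℂ)))
  bounded : ∀ γ : SL(2, ℤ), IsBoundedAtImInfty (f ∣[k] γ)

/-- `f` is an `h`-twisted cusp form of weight `k` for `Γ₁(l)`. -/
structure IsTwistedCuspForm (l : ℕ) (h : ℍ → ℂ) (k : ℤ) (f : ℍ → ℂ) : Prop
    extends IsTwistedModularForm l h k f where
  vanishing : ∀ γ : SL(2, ℤ), IsZeroAtImInfty (f ∣[k] γ)

/-- The pairs `(c, d)` over which the Eisenstein series is summed: `c ∈ lℤ`, `gcd(l, d) = 1`.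
The last condition only matters for `l = 1`, where it removes `(0, 0)`. -/
def EisensteinIndex (l : ℕ) : Type :=
  {p : ℤ × ℤ // (l : ℤ) ∣ p.1 ∧ Int.gcd l p.2 = 1 ∧ p ≠ (0, 0)}

/-- The `(c, d)` term of the `h`-twisted Eisenstein series `E_{k,i;h}`. -/
noncomputable def eisensteinTerm (l : ℕ) (k i : ℤ) (h : ℍ → ℂ) (τ : ℍ)
    (p : EisensteinIndex l) : ℂ :=
  ((p.1.1 : ℂ) * (τ : ℂ) + (p.1.2 : ℂ)) ^ (-k) *
    Complex.exp (-(2 * Real.pi * Complex.I * ((p.1.2 : ℂ) * (i : ℂ) / (l : ℂ)))) *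
    Complex.exp (2 * Real.pi * Complex.I * (reCuspValue h p.1.1 p.1.2 : ℂ))

/-- The `h`-twisted Eisenstein series `E_{k,i;h}` of level `l`. -/
noncomputable def eisenstein (l : ℕ) (k i : ℤ) (h : ℍ → ℂ) (τ : ℍ) : ℂ :=
  ∑' p : EisensteinIndex l, eisensteinTerm l k i h τ p

/-- The group of Möbius transformations of `ℍ` given by the elements of a subgroup `Γ` of
`SL(2, ℤ)`, i.e. the image of `Γ` in the permutations of `ℍ` (so that `-1` becomes trivial). -/
noncomputable def transformations (Γ : Subgroup SL(2, ℤ)) : Subgroup (Equiv.Perm ℍ) :=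
  Γ.map (MulAction.toPermHom SL(2, ℤ) ℍ)

/-- `D` is a (measure-theoretic) fundamental domain for the action of `Γ` on `ℍ`. -/
def IsFundDomain (Γ : Subgroup SL(2, ℤ)) (D : Set ℍ) : Prop :=
  IsFundamentalDomain (transformations Γ) D (volume : Measure ℍ)

/-- The integrand `f(τ) conj(g(τ)) y^k` of the Petersson product, to be integrated against the
hyperbolic measure `dx dy / y ^ 2`, which is the `volume` of `ℍ`. -/
noncomputable def peterssonIntegrand (k : ℤ) (f g : ℍ → ℂ) (τ : ℍ) : ℂ :=
  f τ * (starRingEnd ℂ) (g τ) * ((τ.im : ℝ) : ℂ) ^ k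

/-- The Petersson product `⟨f, g⟩` of weight `k`, computed on the fundamental domain `D`. -/
noncomputable def peterssonInner (D : Set ℍ) (k : ℤ) (f g : ℍ → ℂ) : ℂ :=
  ∫ τ in D, peterssonIntegrand k f g τ

theorem volume_fd_diff_fdo :
    volume (ModularGroup.fd \ ModularGroup.fdo : Set ℍ) = 0 := by
  have h0 : ∀ a : ℝ, volume {z : ℂ | z.re = a} = 0 := by
    intro a
    have hm : MeasurableSet {x : ℝ × ℝ | x.1 = a} :=
      measurableSet_eq_fun measurable_fst measurable_const
    have := Complex.volume_preserving_equiv_real_prod.measure_preimage hm.nullMeasurableSet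
    have h2 : {x : ℝ × ℝ | x.1 = a} = ({a} : Set ℝ) ×ˢ Set.univ := by ext; simp
    rw [h2, Measure.volume_eq_prod, Measure.prod_prod] at this
    simp only [Real.volume_singleton, zero_mul] at this
    convert this using 2
    ext z
    simp
  have h1 : volume (Metric.sphere (0 : ℂ) 1) = 0 := Measure.addHaar_sphere _ _ _
  have h3 : volume ((↑) '' (ModularGroup.fd \ ModularGroup.fdo : Set ℍ) : Set ℂ) = 0 := by
    refine measure_mono_null (t := Metric.sphere (0 : ℂ) 1 ∪ ({z : ℂ | z.re = 1 / 2} ∪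
      {z : ℂ | z.re = -(1 / 2)})) ?_ (measure_union_null h1 (measure_union_null (h0 _) (h0 _)))
    rintro _ ⟨z, ⟨⟨hz1, hz2⟩, hz3⟩, rfl⟩
    by_contra hcon
    simp only [Set.mem_union, mem_sphere_iff_norm, sub_zero, Set.mem_ofPred_eq, not_or] at hcon
    obtain ⟨c1, c2, c3⟩ := hcon
    refine hz3 ⟨lt_of_le_of_ne hz1 fun he => c1 ?_, lt_of_le_of_ne hz2 fun he => ?_⟩
    · rw [Complex.normSq_eq_norm_sq] at he
      nlinarith [norm_nonneg (z : ℂ)]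
    · rcases abs_eq (by norm_num : (0 : ℝ) ≤ 1 / 2) |>.1 he with h | h
      · exact c2 h
      · exact c3 h
  rw [volume_eq_lintegral]
  exact setLIntegral_measure_zero _ _ h3

/-- Fundamental domains exist. -/
theorem exists_isFundDomain (Γ : Subgroup SL(2, ℤ)) : ∃ D : Set ℍ, IsFundDomain Γ D := by
  classical
  let φ := MulAction.toPermHom SL(2, ℤ) ℍ
  let G := transformations Γ
  have hφ : ∀ (g : SL(2, ℤ)) (z : ℍ), φ g z = g • z := fun _ _ => rfl
  have hG : G ≤ φ.range := by
    rintro _ ⟨g, -, rfl⟩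
    exact ⟨g, rfl⟩
  have hcont : ∀ g : SL(2, ℤ), Continuous fun z : ℍ => g • z := fun g =>
    continuous_const_smul (Matrix.SpecialLinearGroup.mapGL ℝ g)
  have hinj : ∀ p ∈ φ.range, ∀ q ∈ φ.range, ∀ z ∈ ModularGroup.fdo, ∀ w ∈ ModularGroup.fdo,
      p z = q w → p = q := by
    rintro _ ⟨a, rfl⟩ _ ⟨b, rfl⟩ z hz w hw h
    have hw' : (b⁻¹ * a) • z = w := by
      rw [hφ, hφ] at h
      rw [mul_smul, h, inv_smul_smul]
    have h1 : φ (b⁻¹ * a) = 1 := by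
      rcases ModularGroup.eq_one_or_neg_one_of_mem_fdo_mem_fdo hz (hw' ▸ hw) with h | h
      · rw [h, map_one]
      · rw [h]
        ext z
        simp [hφ]
    rw [map_mul, map_inv] at h1
    exact (inv_mul_eq_one.1 h1).symm
  let rep : Equiv.Perm ℍ → Equiv.Perm ℍ := fun p =>
    (Quotient.mk (QuotientGroup.rightRel G) p).out
  have hrep : ∀ p, rep p * p⁻¹ ∈ G := fun p => by
    have := Quotient.mk_out (s := QuotientGroup.rightRel G) p
    have h2 := QuotientGroup.rightRel_apply.1 this
    simpa using G.inv_mem h2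
  have hrep' : ∀ p, ∀ γ ∈ G, rep (γ * p) = rep p := fun p γ hγ => by
    have : Quotient.mk (QuotientGroup.rightRel G) (γ * p) =
        Quotient.mk (QuotientGroup.rightRel G) p :=
      Quotient.sound (QuotientGroup.rightRel_apply.2 (by simpa using G.inv_mem hγ))
    simp only [rep, this]
  let D : Set ℍ := {x | ∃ g : SL(2, ℤ), rep (φ g) = φ g ∧ ∃ z ∈ ModularGroup.fdo, g • z = x}
  have hopen : IsOpen D := by
    have : D = ⋃ g : {g : SL(2, ℤ) // rep (φ g) = φ g},
        (fun z : ℍ => (g.1)⁻¹ • z) ⁻¹' ModularGroup.fdo := by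
      ext x
      simp only [D, Set.mem_ofPred_eq, Set.mem_iUnion, Set.mem_preimage, Subtype.exists]
      constructor
      · rintro ⟨g, hg, z, hz, rfl⟩
        exact ⟨g, hg, by simpa using hz⟩
      · rintro ⟨g, hg, hz⟩
        exact ⟨g, hg, _, hz, smul_inv_smul g x⟩
    rw [this]
    exact isOpen_iUnion fun g => ModularGroup.isOpen_fdo.preimage (hcont _)
  refine ⟨D, hopen.measurableSet.nullMeasurableSet, ?_, ?_⟩
  · have hnull : ∀ᵐ x : ℍ, ∀ g : SL(2, ℤ), g • x ∉ (ModularGroup.fd \ ModularGroup.fdo : Set ℍ) := by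
      have : Countable SL(2, ℤ) :=
        Function.Injective.countable (β := Fin 2 → Fin 2 → ℤ)
          (f := fun g i j => g i j) fun a b hab => by
            ext i j
            exact congrFun (congrFun hab i) j
      rw [ae_all_iff]
      intro g
      have := measure_preimage_smul (volume : Measure ℍ)
        (Matrix.SpecialLinearGroup.mapGL ℝ g) (ModularGroup.fd \ ModularGroup.fdo : Set ℍ)
      rw [volume_fd_diff_fdo] at this
      exact compl_mem_ae_iff.2 this
    filter_upwards [hnull] with x hx
    obtain ⟨g, hg⟩ := ModularGroup.exists_smul_mem_fd x
    have hgo : g • x ∈ ModularGroup.fdo := by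
      by_contra hcon
      exact hx g ⟨hg, hcon⟩
    let p := rep (φ g⁻¹)
    have hp : p * (φ g⁻¹)⁻¹ ∈ G := hrep _
    have hpr : p ∈ φ.range := by
      have := φ.range.mul_mem (hG hp) ⟨g⁻¹, rfl⟩
      simpa using this
    obtain ⟨a, ha⟩ := hpr
    refine ⟨⟨_, hp⟩, a, ?_, g • x, hgo, ?_⟩
    · rw [ha]
      have := hrep' (φ g⁻¹) _ hp
      rwa [inv_mul_cancel_right] at this
    · rw [← hφ a, ha]
      change p (g • x) = p ((φ g⁻¹)⁻¹ x)
      rw [map_inv, inv_inv, hφ]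
  · have hkey : ∀ γ ∈ G, ∀ γ' ∈ G, ∀ x ∈ D, ∀ y ∈ D, γ x = γ' y → γ = γ' := by
      rintro γ hγ γ' hγ' _ ⟨a, ha, z, hz, rfl⟩ _ ⟨b, hb, w, hw, rfl⟩ h
      have h1 : γ * φ a = γ' * φ b :=
        hinj _ (φ.range.mul_mem (hG hγ) ⟨a, rfl⟩) _ (φ.range.mul_mem (hG hγ') ⟨b, rfl⟩) z hz w hw h
      have h2 : φ a = φ b := by
        rw [← ha, ← hb, ← hrep' _ γ hγ, h1, hrep' _ γ' hγ']
      rw [h2] at h1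
      exact mul_right_cancel h1
    intro γ γ' hne
    refine Disjoint.aedisjoint (Set.disjoint_left.2 ?_)
    rintro _ ⟨x, hx, rfl⟩ ⟨y, hy, h⟩
    exact hne (Subtype.ext (hkey _ γ'.2 _ γ.2 y hy x hx h)).symm

end TwistedModular

namespace TwistedModular

open Filter Topology

/-! The proof is a Rankin unfolding, made possible by the twist being a character. Let `F` be the
primitive of `h` vanishing at `i∞`. For `γ ∈ Γ₀(l)` with bottom row `(c, d)`, `H(-d/c) = F(τ) -
F(γτ)` up to the convention at `c = 0`, independently of `τ` (`reCuspValue_eq`). Hence the phase is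
multiplicative on `Γ₀(l)` (`cuspPhase_mul`). It is trivial on the parabolic elements `σ Tⁿ σ⁻¹`,
because `h` vanishes at every cusp (`reCuspValue_conj_T_zpow`). So every slash `g ∣ σ` is genuinely
periodic, decays exponentially, and `|g|² y^k` is bounded.

Each pair `(c, d)` is `n` times the bottom row of some `δ ∈ Γ₀(l)`, with `n` prime to `l`; `δ` is
unique up to left multiplication by powers of `T`, and asking that `δτ` lie in the strip `0 ≤ x < 1`
fixes it. Writing `δ = σγ` with `γ ∈ Γ₁(l)` turns the Petersson integrand into a finite combination,
over `σ ∈ Γ₀(l)/Γ₁(l)`, of sums over `Γ₁(l)` of `conj (g ∣ σ⁻¹) y^k` cut off to the strip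
(`peterssonIntegrand_eq`). Unfolding over a fundamental domain leaves integrals over the strip.
These vanish since the inner integral over `x` is the conjugate of the constant Fourier coefficient
of the cuspidal function `g ∣ σ⁻¹` (`integrable_and_integral_strip`). -/

/-! ### Primitives on the upper half plane and integrals along vertical lines. -/

/-- A `1`-periodic holomorphic function on `ℍ` vanishing at `i∞` has a primitive vanishing
at `i∞`. -/
theorem exists_primitive {f : ℍ → ℂ} (hper : Function.Periodic (f ∘ ofComplex) (1 : ℝ))
    (hhol : MDifferentiable 𝓘(ℂ) 𝓘(ℂ) f) (hzero : IsZeroAtImInfty f) :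
    ∃ F : ℍ → ℂ, (∀ τ : ℍ, HasDerivAt (F ∘ ofComplex) (f τ) τ) ∧ Tendsto F atImInfty (𝓝 0) := by
  have hd := differentiableOn_cuspFunction_ball one_pos hper hhol hzero.isBoundedAtImInfty
  have h0 : cuspFunction 1 f 0 = 0 := hzero.cuspFunction_apply_zero one_pos
  -- In the variable `q = e^{2πiτ}` the primitive must satisfy `dG/dq = f / (2πi q)`. This is
  -- holomorphic at `q = 0` because the cusp function vanishes there, and `dslope` is the quotient
  -- with the singularity removed.
  have hd2 : DifferentiableOn ℂ
      (fun q => (2 * Real.pi * Complex.I)⁻¹ * dslope (cuspFunction 1 f) 0 q)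
      (Metric.ball 0 1) :=
    ((Complex.differentiableOn_dslope (Metric.ball_mem_nhds _ one_pos)).2 hd).const_mul _
  obtain ⟨G, hG0, hG⟩ := hd2.isExactOn_ball.with_val_at 0 0
  refine ⟨fun τ => G (Function.Periodic.qParam 1 τ), fun τ => ?_, ?_⟩
  · have hq1 : ‖Function.Periodic.qParam 1 τ‖ < 1 :=
      Function.Periodic.norm_qParam_lt_one one_pos τ.im_pos
    have hq0 : Function.Periodic.qParam 1 τ ≠ 0 := Function.Periodic.qParam_ne_zero _
    have hqd : HasDerivAt (Function.Periodic.qParam 1)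
        (Function.Periodic.qParam 1 τ * (2 * Real.pi * Complex.I)) τ := by
      have : HasDerivAt (fun z : ℂ => 2 * Real.pi * Complex.I * z / (1 : ℝ))
          (2 * Real.pi * Complex.I) τ := by
        simpa using (hasDerivAt_id (τ : ℂ)).const_mul (2 * Real.pi * Complex.I)
      exact this.cexp
    have := (hG _ (by simpa using hq1)).comp (τ : ℂ) hqd
    have hval : (2 * Real.pi * Complex.I)⁻¹ *
        dslope (cuspFunction 1 f) 0 (Function.Periodic.qParam 1 τ) *
        (Function.Periodic.qParam 1 τ * (2 * Real.pi * Complex.I)) = f τ := by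
      rw [dslope_of_ne _ hq0, slope_def_field, h0, sub_zero, sub_zero,
        eq_cuspFunction τ one_ne_zero hper]
      have := Complex.two_pi_I_ne_zero
      field_simp
    rw [hval] at this
    refine this.congr_of_eventuallyEq ?_
    filter_upwards [eventuallyEq_coe_comp_ofComplex τ.im_pos] with z hz
    simp only [Function.comp_apply, id_eq] at hz ⊢
    rw [hz]
  · have hc : ContinuousAt G 0 := (hG 0 (by simp)).continuousAt
    have := hc.tendsto.comp (qParam_tendsto_atImInfty one_pos)
    rwa [hG0] at this

/-- The weight-2 factor is exactly the derivative of the Möbius map, so this is the chain rule. -/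
theorem hasDerivAt_comp_smul {f F : ℍ → ℂ}
    (hF : ∀ τ : ℍ, HasDerivAt (F ∘ ofComplex) (f τ) τ) (γ : SL(2, ℤ)) (τ : ℍ) :
    HasDerivAt ((fun w : ℍ => F (γ • w)) ∘ ofComplex) ((f ∣[(2 : ℤ)] γ) τ) τ := by
  have hdet : ((γ : GL (Fin 2) ℝ)).val.det = 1 :=
    (Matrix.SpecialLinearGroup.map (Int.castRingHom ℝ) γ).det_coe
  have h1 := (hasStrictDerivAt_smul (g := (γ : GL (Fin 2) ℝ)) (by rw [hdet]; exact one_pos)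
    τ).hasDerivAt
  have h2 : HasDerivAt (F ∘ ofComplex) (f (γ • τ))
      (((γ : GL (Fin 2) ℝ) • ofComplex (τ : ℂ) : ℍ) : ℂ) := by
    rw [ofComplex_apply]; exact hF (γ • τ)
  have h3 := h2.comp (τ : ℂ) h1
  rw [hdet] at h3
  have hv : (f ∣[(2 : ℤ)] γ) τ = f (γ • τ) * ((1 : ℝ) / denom γ τ ^ 2) := by
    rw [ModularForm.SL_slash_apply, zpow_neg]
    norm_num
  rw [hv]
  refine h3.congr_of_eventuallyEq (Eventually.of_forall fun z => ?_)
  simp only [Function.comp_apply, ofComplex_apply]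
  rfl

theorem eq_of_hasDerivAt_zero {F : ℍ → ℂ} (hF : ∀ τ : ℍ, HasDerivAt (F ∘ ofComplex) 0 τ)
    (τ τ' : ℍ) : F τ = F τ' := by
  have hconv : Convex ℝ {z : ℂ | 0 < z.im} := convex_halfSpace_im_gt 0
  have := hconv.is_const_of_fderivWithin_eq_zero (𝕜 := ℂ) (f := F ∘ ofComplex)
    (fun z hz => (hF ⟨z, hz⟩).differentiableAt.differentiableWithinAt)
    (fun z hz => by
      rw [(hF ⟨z, hz⟩).hasFDerivAt.hasFDerivWithinAt.fderivWithin
        ((isOpen_upperHalfPlaneSet).uniqueDiffWithinAt hz)]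
      ext; simp) τ.im_pos τ'.im_pos
  simpa using this

/-- `F ∘ γ - F` has derivative `f ∣ γ - f = 0`; its constant value is the period attached to `γ`. -/
theorem smul_sub_eq_smul_sub {f F : ℍ → ℂ}
    (hF : ∀ τ : ℍ, HasDerivAt (F ∘ ofComplex) (f τ) τ) {γ : SL(2, ℤ)}
    (hγ : f ∣[(2 : ℤ)] γ = f) (τ τ' : ℍ) :
    F (γ • τ) - F τ = F (γ • τ') - F τ' := by
  refine eq_of_hasDerivAt_zero (F := fun w => F (γ • w) - F w) (fun w => ?_) τ τ'
  have := (hasDerivAt_comp_smul hF γ w).sub (hF w)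
  rw [hγ, sub_self] at this
  exact this

theorem tendsto_im_sq_mul_of_exp_decay {f : ℍ → ℂ}
    (hf : f =O[atImInfty] fun τ => Real.exp (-2 * Real.pi * τ.im / 1)) :
    Tendsto (fun τ : ℍ => ‖f τ‖ * τ.im ^ 2) atImInfty (𝓝 0) := by
  have h1 : Tendsto (fun y : ℝ => Real.exp (-2 * Real.pi * y / 1) * y ^ 2) atTop (𝓝 0) := by
    have := tendsto_rpow_mul_exp_neg_mul_atTop_nhds_zero 2 (2 * Real.pi) Real.two_pi_pos
    refine this.congr fun y => ?_
    rw [mul_comm, Real.rpow_two]; congr 2; ring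
  have h2 := h1.comp (tendsto_comap (f := UpperHalfPlane.im) (x := atTop))
  refine (hf.norm_left.mul (Asymptotics.isBigO_refl (fun τ : ℍ => τ.im ^ 2) _)).trans_tendsto h2

/-- The point `x + i t` for `t > 0`. -/
noncomputable def verticalPoint (x : ℝ) (t : ℝ) : ℍ := ofComplex (x + t * Complex.I)

theorem coe_verticalPoint (x : ℝ) {t : ℝ} (ht : 0 < t) :
    (verticalPoint x t : ℂ) = x + t * Complex.I := by
  rw [verticalPoint, ofComplex_apply_of_im_pos (by simpa using ht)]

theorem im_verticalPoint (x : ℝ) {t : ℝ} (ht : 0 < t) : (verticalPoint x t).im = t := by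
  rw [← coe_im, coe_verticalPoint x ht]; simp

theorem tendsto_verticalPoint (x : ℝ) : Tendsto (verticalPoint x) atTop atImInfty := by
  refine tendsto_comap_iff.2 (tendsto_id.congr' ?_)
  filter_upwards [eventually_gt_atTop 0] with t ht
  simp [im_verticalPoint x ht]

theorem hasDerivAt_comp_verticalPoint {f F : ℍ → ℂ}
    (hF : ∀ τ : ℍ, HasDerivAt (F ∘ ofComplex) (f τ) τ) (x : ℝ) {t : ℝ} (ht : 0 < t) :
    HasDerivAt (fun t => F (verticalPoint x t)) (f (verticalPoint x t) * Complex.I) t := by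
  have h1 := hF (verticalPoint x t)
  rw [coe_verticalPoint x ht] at h1
  have h2 : HasDerivAt (fun s : ℝ => (x : ℂ) + s * Complex.I) Complex.I t := by
    simpa using ((Complex.ofRealCLM.hasDerivAt (x := t)).mul_const Complex.I).const_add (x : ℂ)
  exact h1.comp_of_eq t h2 rfl

theorem continuousOn_comp_verticalPoint {f : ℍ → ℂ} (hf : Continuous f) (x : ℝ) :
    ContinuousOn (fun t => f (verticalPoint x t)) (Set.Ioi 0) := by
  refine hf.comp_continuousOn ?_
  refine ContinuousOn.comp (t := {z : ℂ | 0 < z.im}) (g := ofComplex) ?_ (by fun_prop)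
    fun t ht => by simpa using ht
  exact fun z hz => (contMDiffAt_ofComplex (n := 1) hz).continuousAt.continuousWithinAt

theorem denom_verticalPoint (γ : SL(2, ℤ)) (hc : γ 1 0 ≠ 0) {t : ℝ} (ht : 0 < t) :
    denom γ (verticalPoint (-((γ 1 1 : ℝ) / (γ 1 0 : ℝ))) t) = (γ 1 0 : ℂ) * (t * Complex.I) := by
  have hc' : ((γ 1 0 : ℤ) : ℂ) ≠ 0 := by exact_mod_cast hc
  rw [ModularGroup.denom_apply, coe_verticalPoint _ ht]
  push_cast
  field_simp
  ring

theorem im_smul_verticalPoint (γ : SL(2, ℤ)) (hc : γ 1 0 ≠ 0) {t : ℝ} (ht : 0 < t) :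
    (γ • verticalPoint (-((γ 1 1 : ℝ) / (γ 1 0 : ℝ))) t).im = ((γ 1 0 : ℝ) ^ 2 * t)⁻¹ := by
  have hc' : ((γ 1 0 : ℤ) : ℝ) ≠ 0 := by exact_mod_cast hc
  rw [ModularGroup.im_smul_eq_div_normSq, denom_verticalPoint γ hc ht, im_verticalPoint _ ht]
  simp
  field_simp

theorem tendsto_smul_verticalPoint (γ : SL(2, ℤ)) (hc : γ 1 0 ≠ 0) :
    Tendsto (fun t => γ • verticalPoint (-((γ 1 1 : ℝ) / (γ 1 0 : ℝ))) t) (𝓝[>] 0) atImInfty := by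
  have hc' : 0 < ((γ 1 0 : ℤ) : ℝ) ^ 2 := by positivity
  refine tendsto_comap_iff.2 ?_
  have : Tendsto (fun t : ℝ => (((γ 1 0 : ℤ) : ℝ) ^ 2)⁻¹ * t⁻¹) (𝓝[>] 0) atTop :=
    tendsto_inv_nhdsGT_zero.const_mul_atTop (by positivity)
  refine this.congr' ?_
  filter_upwards [self_mem_nhdsWithin] with t ht
  simp only [Function.comp_apply]
  rw [im_smul_verticalPoint γ hc ht, mul_inv]

/-- Since `γ` sends `-d/c` to `i∞`, the point at height `t` goes to height `1/(c²t)`. By invariance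
`|f|` at the former equals `c² |f| y²` at the latter, and exponential decay beats `y²`. -/
theorem tendsto_comp_verticalPoint {f : ℍ → ℂ}
    (hdecay : f =O[atImInfty] fun τ => Real.exp (-2 * Real.pi * τ.im / 1))
    {γ : SL(2, ℤ)} (hγ : f ∣[(2 : ℤ)] γ = f) (hc : γ 1 0 ≠ 0) :
    Tendsto (fun t => f (verticalPoint (-((γ 1 1 : ℝ) / (γ 1 0 : ℝ))) t)) (𝓝[>] 0) (𝓝 0) := by
  have hc' : ((γ 1 0 : ℤ) : ℝ) ≠ 0 := by exact_mod_cast hc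
  have h1 := ((tendsto_im_sq_mul_of_exp_decay hdecay).comp
    (tendsto_smul_verticalPoint γ hc)).const_mul ((γ 1 0 : ℝ) ^ 2)
  rw [mul_zero] at h1
  rw [tendsto_zero_iff_norm_tendsto_zero]
  refine h1.congr' ?_
  filter_upwards [self_mem_nhdsWithin] with t ht
  have ht' : (t : ℝ) ≠ 0 := ne_of_gt ht
  conv_rhs => rw [← hγ]
  simp only [Function.comp_apply]
  rw [ModularForm.SL_slash_apply, im_smul_verticalPoint γ hc ht, denom_verticalPoint γ hc ht,
    norm_mul, norm_zpow]
  simp only [norm_mul, Complex.norm_I, mul_one, Complex.norm_real, Complex.norm_intCast,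
    Real.norm_eq_abs, zpow_neg]
  rw [show (2 : ℤ) = ((2 : ℕ) : ℤ) from rfl, zpow_natCast, mul_pow, sq_abs, sq_abs]
  field_simp

theorem integrableOn_comp_verticalPoint {f : ℍ → ℂ} (hf : Continuous f)
    (hdecay : f =O[atImInfty] fun τ => Real.exp (-2 * Real.pi * τ.im / 1))
    {γ : SL(2, ℤ)} (hγ : f ∣[(2 : ℤ)] γ = f) (hc0 : γ 1 0 ≠ 0) :
    IntegrableOn (fun t => f (verticalPoint (-((γ 1 1 : ℝ) / (γ 1 0 : ℝ))) t)) (Set.Ioi 0) := by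
  set x : ℝ := -((γ 1 1 : ℝ) / (γ 1 0 : ℝ)) with hx
  -- Setting the value at `t = 0` to the limit `0` gives continuity on the closed half-line, so only
  -- the decay at infinity remains to be used.
  have key : IntegrableOn (Function.update (fun t => f (verticalPoint x t)) 0 0) (Set.Ioi 0) := by
    suffices hco : ContinuousOn (Function.update (fun t => f (verticalPoint x t)) 0 0) (Set.Ici 0) ∧
        Function.update (fun t => f (verticalPoint x t)) 0 0
          =O[atTop] fun t => Real.exp (-(2 * Real.pi) * t) by
      obtain ⟨hc, ho⟩ := hco
      exact ((hc.locallyIntegrableOn measurableSet_Ici).integrableOn_of_isBigO_atTop ho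
        ⟨Set.Ioi 0, Ioi_mem_atTop 0, exp_neg_integrableOn_Ioi 0 Real.two_pi_pos⟩).mono_set
          Set.Ioi_subset_Ici_self
    refine ⟨fun t ht => ?_, ?_⟩
    · rcases (Set.mem_Ici.1 ht).eq_or_lt with rfl | ht
      · rw [continuousWithinAt_update_same]
        simpa using tendsto_comp_verticalPoint hdecay hγ hc0
      · have := (continuousOn_comp_verticalPoint hf x).continuousAt (Ioi_mem_nhds ht)
        exact ((continuousAt_update_of_ne ht.ne').2 this).continuousWithinAt
    · have := hdecay.comp_tendsto (tendsto_verticalPoint x)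
      refine this.congr' ?_ ?_
      · filter_upwards [eventually_gt_atTop 0] with t ht
        simp [Function.update_of_ne ht.ne']
      · filter_upwards [eventually_gt_atTop 0] with t ht
        simp [im_verticalPoint x ht]
  refine key.congr_fun (fun t ht => ?_) measurableSet_Ioi
  simp [Function.update_of_ne (Set.mem_Ioi.1 ht).ne']

/-- This is the fundamental theorem of calculus on the vertical line above `-d/c`. At its foot
`F(γ·)` tends to `0`, so `F` tends there to the constant `F - F ∘ γ`. -/
theorem antiderivative_eq {f F : ℍ → ℂ} (hf : Continuous f)
    (hdecay : f =O[atImInfty] fun τ => Real.exp (-2 * Real.pi * τ.im / 1))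
    (hF : ∀ τ : ℍ, HasDerivAt (F ∘ ofComplex) (f τ) τ) (hF0 : Tendsto F atImInfty (𝓝 0))
    {γ : SL(2, ℤ)} (hγ : f ∣[(2 : ℤ)] γ = f) (hc : γ 1 0 ≠ 0) (τ : ℍ) :
    antiderivative f (-(((γ 1 1 : ℤ) : ℂ) / ((γ 1 0 : ℤ) : ℂ))) = F τ - F (γ • τ) := by
  set x : ℝ := -((γ 1 1 : ℝ) / (γ 1 0 : ℝ)) with hx
  have hlim : Tendsto (fun t => F (verticalPoint x t)) (𝓝[>] 0) (𝓝 (F τ - F (γ • τ))) := by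
    have h1 := (hF0.comp (tendsto_smul_verticalPoint γ hc)).sub_const (F (γ • τ) - F τ)
    rw [zero_sub, neg_sub] at h1
    refine h1.congr fun t => ?_
    simp only [Function.comp_apply]
    rw [smul_sub_eq_smul_sub hF hγ τ (verticalPoint x t)]
    ring
  have hint := integrableOn_comp_verticalPoint hf hdecay hγ hc
  have h2 := integral_Ioi_of_hasDerivAt_of_tendsto (a := 0) (m := 0)
    (f := Function.update (fun t => F (verticalPoint x t)) 0 (F τ - F (γ • τ)))
    (f' := fun t => f (verticalPoint x t) * Complex.I)
    (by rw [continuousWithinAt_update_same]; simpa using hlim)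
    (fun t ht => ?_) (hint.mul_const _) ?_
  · rw [integral_mul_const] at h2
    simp only [Function.update_self, zero_sub] at h2
    rw [antiderivative, ← neg_inj, ← h2, mul_comm _ Complex.I, hx]
    simp [verticalPoint]
  · refine (hasDerivAt_comp_verticalPoint hF x ht).congr_of_eventuallyEq ?_
    filter_upwards [Ioi_mem_nhds ht] with s hs
    simp [Function.update_of_ne (Set.mem_Ioi.1 hs).ne']
  · refine (hF0.comp (tendsto_verticalPoint x)).congr' ?_
    filter_upwards [eventually_gt_atTop 0] with t ht
    simp [Function.update_of_ne ht.ne']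

/-! ### The real part of `H(-d/c)` as a homomorphism on `Γ₀(l)`. -/

section CuspForm

variable {l : ℕ} (h : CuspForm ((Gamma0 l).map (Matrix.SpecialLinearGroup.mapGL ℝ)) 2)

theorem one_mem_strictPeriods_Gamma0 (l : ℕ) :
    (1 : ℝ) ∈ ((Gamma0 l).map (Matrix.SpecialLinearGroup.mapGL ℝ)).strictPeriods := by
  simp

theorem isCusp_infty_Gamma0 (l : ℕ) :
    Fact (IsCusp OnePoint.infty ((Gamma0 l).map (Matrix.SpecialLinearGroup.mapGL ℝ))) :=
  ⟨Subgroup.isCusp_of_mem_strictPeriods one_pos (one_mem_strictPeriods_Gamma0 l)⟩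

theorem slash_eq_of_mem_Gamma0 {γ : SL(2, ℤ)} (hγ : γ ∈ Gamma0 l) :
    (h : ℍ → ℂ) ∣[(2 : ℤ)] γ = h :=
  SlashInvariantFormClass.slash_action_eq h _ (Subgroup.mem_map_of_mem _ hγ)

/-- A primitive of `h` on the upper half plane. -/
structure IsPrimitive (f F : ℍ → ℂ) : Prop where
  deriv : ∀ τ : ℍ, HasDerivAt (F ∘ ofComplex) (f τ) τ
  tendsto : Tendsto F atImInfty (𝓝 0)

theorem exists_isPrimitive : ∃ F, IsPrimitive h F := by
  have := isCusp_infty_Gamma0 l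
  obtain ⟨F, h1, h2⟩ := exists_primitive
    (SlashInvariantFormClass.periodic_comp_ofComplex h (one_mem_strictPeriods_Gamma0 l))
    (CuspFormClass.holo h) (CuspFormClass.zero_at_infty h)
  exact ⟨F, h1, h2⟩

theorem im_smul_of_lower_left_eq_zero {γ : SL(2, ℤ)} (hc : γ 1 0 = 0) (τ : ℍ) :
    (γ • τ).im = τ.im := by
  have hd : γ 0 0 * γ 1 1 = 1 := by
    have := Matrix.det_fin_two γ.1
    rw [γ.2, hc] at this
    linarith
  have h2 : γ 1 1 = 1 ∨ γ 1 1 = -1 := by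
    rcases Int.mul_eq_one_iff_eq_one_or_neg_one.1 hd with h | h <;> simp [h]
  rw [ModularGroup.im_smul_eq_div_normSq, ModularGroup.denom_apply, hc]
  rcases h2 with h | h <;> simp [h]

/-- When `c = 0`, `γ` preserves heights, so the constant `F - F ∘ γ` tends to `0` at `i∞`; this
matches the convention `H(-d/0) = 0`. -/
theorem reCuspValue_eq {F : ℍ → ℂ} (hF : IsPrimitive h F) {γ : SL(2, ℤ)} (hγ : γ ∈ Gamma0 l)
    (τ : ℍ) : reCuspValue h (γ 1 0) (γ 1 1) = (F τ - F (γ • τ)).re := by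
  have hs := slash_eq_of_mem_Gamma0 h hγ
  have := isCusp_infty_Gamma0 l
  by_cases hc : γ 1 0 = 0
  · rw [reCuspValue, if_pos hc]
    have h1 : Tendsto (fun τ => γ • τ) atImInfty atImInfty :=
      tendsto_comap_iff.2 (tendsto_comap.congr fun τ => (im_smul_of_lower_left_eq_zero hc τ).symm)
    have h2 := hF.tendsto.sub (hF.tendsto.comp h1)
    have h3 : Tendsto (fun _ : ℍ => F τ - F (γ • τ)) atImInfty (𝓝 (0 - 0)) := by
      refine h2.congr fun τ' => ?_
      have := smul_sub_eq_smul_sub hF.deriv hs τ τ'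
      simp only [Function.comp_apply]
      linear_combination this
    have h4 := tendsto_nhds_unique h3 tendsto_const_nhds
    rw [← h4]; simp
  · rw [reCuspValue, if_neg hc, antiderivative_eq (CuspFormClass.holo h).continuous
      (CuspFormClass.exp_decay_atImInfty h one_pos (one_mem_strictPeriods_Gamma0 l)) hF.deriv
      hF.tendsto hs hc τ]

theorem reCuspValue_mul {γ δ : SL(2, ℤ)} (hγ : γ ∈ Gamma0 l) (hδ : δ ∈ Gamma0 l) :
    reCuspValue h ((γ * δ) 1 0) ((γ * δ) 1 1) =
      reCuspValue h (γ 1 0) (γ 1 1) + reCuspValue h (δ 1 0) (δ 1 1) := by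
  obtain ⟨F, hF⟩ := exists_isPrimitive h
  rw [reCuspValue_eq h hF (mul_mem hγ hδ) I, reCuspValue_eq h hF hδ I,
    reCuspValue_eq h hF hγ (δ • I), mul_smul, ← Complex.add_re]
  congr 1
  ring

/-- The value is the real part of the increment of `F ∘ σ` between `τ + n` and `τ`. The derivative
`h ∣ σ` is arbitrarily small high up while the segment keeps length `|n|`, so the mean value
inequality forces `0`. -/
theorem reCuspValue_conj_T_zpow [NeZero l] (σ : SL(2, ℤ)) (n : ℤ)
    (hγ : σ * ModularGroup.T ^ n * σ⁻¹ ∈ Gamma0 l) :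
    reCuspValue h ((σ * ModularGroup.T ^ n * σ⁻¹) 1 0) ((σ * ModularGroup.T ^ n * σ⁻¹) 1 1)
      = 0 := by
  obtain ⟨F, hF⟩ := exists_isPrimitive h
  have hd := hasDerivAt_comp_smul hF.deriv σ
  have hz : IsZeroAtImInfty ((h : ℍ → ℂ) ∣[(2 : ℤ)] σ) := CuspFormClass.zero_at_infty_slash h σ
  have hval : ∀ τ : ℍ, reCuspValue h ((σ * ModularGroup.T ^ n * σ⁻¹) 1 0)
      ((σ * ModularGroup.T ^ n * σ⁻¹) 1 1) = (F (σ • τ) - F (σ • ((n : ℝ) +ᵥ τ))).re := by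
    intro τ
    rw [reCuspValue_eq h hF hγ (σ • τ), mul_smul, inv_smul_smul, mul_smul, modular_T_zpow_smul]
  have hb : ∀ ε > 0, |reCuspValue h ((σ * ModularGroup.T ^ n * σ⁻¹) 1 0)
      ((σ * ModularGroup.T ^ n * σ⁻¹) 1 1)| ≤ ε * |(n : ℝ)| := by
    intro ε hε
    obtain ⟨A, hA⟩ := isZeroAtImInfty_iff.1 hz ε hε
    set B := max A 1
    let τ : ℍ := ⟨B * Complex.I, by simp [B]⟩
    rw [hval τ]
    refine (Complex.abs_re_le_norm _).trans ?_
    have hconv : Convex ℝ {z : ℂ | B ≤ z.im} := convex_halfSpace_im_ge B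
    have hB : 0 < B := lt_of_lt_of_le one_pos (le_max_right _ _)
    have := hconv.norm_image_sub_le_of_norm_hasDerivWithin_le (𝕜 := ℂ) (C := ε)
      (f := (fun w : ℍ => F (σ • w)) ∘ ofComplex)
      (f' := ((h : ℍ → ℂ) ∣[(2 : ℤ)] σ) ∘ ofComplex)
      (x := (((n : ℝ) +ᵥ τ : ℍ) : ℂ)) (y := (τ : ℂ))
      (fun z hz => by
        have hz' : 0 < z.im := hB.trans_le hz
        have := hd ⟨z, hz'⟩
        rw [Function.comp_apply, ofComplex_apply_of_im_pos hz']
        exact this.hasDerivWithinAt)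
      (fun z hz => by
        have hz' : 0 < z.im := hB.trans_le hz
        rw [Function.comp_apply, ofComplex_apply_of_im_pos hz']
        exact hA _ ((le_max_left _ _).trans hz))
      (by simp [τ]) (by simp [τ])
    rw [Function.comp_apply, Function.comp_apply, ofComplex_apply, ofComplex_apply] at this
    simpa [-ModularGroup.sl_moeb] using this
  refine abs_nonpos_iff.1 (le_of_forall_pos_le_add fun ε hε => ?_)
  refine (hb (ε / (|(n : ℝ)| + 1)) (by positivity)).trans ?_
  rw [zero_add, div_mul_eq_mul_div, div_le_iff₀ (by positivity)]
  nlinarith [abs_nonneg (n : ℝ)]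

end CuspForm

/-! ### The phase, and growth of twisted cusp forms. -/

/-- The phase `e^{2 π i Re H(-d/c)}`. -/
noncomputable def cuspPhase (h : ℍ → ℂ) (c d : ℤ) : ℂ :=
  Complex.exp (2 * Real.pi * Complex.I * (reCuspValue h c d : ℂ))

theorem norm_cuspPhase (h : ℍ → ℂ) (c d : ℤ) : ‖cuspPhase h c d‖ = 1 := by
  rw [cuspPhase, show (2 * Real.pi * Complex.I * (reCuspValue h c d : ℂ)) =
    ((2 * Real.pi * reCuspValue h c d : ℝ) : ℂ) * Complex.I by push_cast; ring,
    Complex.norm_exp_ofReal_mul_I]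

theorem conj_inv_cuspPhase (h : ℍ → ℂ) (c d : ℤ) :
    (starRingEnd ℂ) (cuspPhase h c d)⁻¹ = cuspPhase h c d := by
  rw [Complex.inv_eq_conj (norm_cuspPhase h c d), Complex.conj_conj]

theorem cuspPhase_mul {l : ℕ}
    (h : CuspForm ((Gamma0 l).map (Matrix.SpecialLinearGroup.mapGL ℝ)) 2)
    {γ δ : SL(2, ℤ)} (hγ : γ ∈ Gamma0 l) (hδ : δ ∈ Gamma0 l) :
    cuspPhase h ((γ * δ) 1 0) ((γ * δ) 1 1) =
      cuspPhase h (γ 1 0) (γ 1 1) * cuspPhase h (δ 1 0) (δ 1 1) := by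
  rw [cuspPhase, reCuspValue_mul h hγ hδ, cuspPhase, cuspPhase, ← Complex.exp_add]
  push_cast
  ring_nf

theorem mem_Gamma1_iff {l : ℕ} (γ : Gamma0 l) : (γ : SL(2, ℤ)) ∈ Gamma1 l ↔ γ ∈ Gamma1' l := by
  rw [Gamma1_to_Gamma0_mem, Gamma1_mem]

theorem conj_mem_Gamma1 {l : ℕ} {σ γ : SL(2, ℤ)} (hσ : σ ∈ Gamma0 l) (hγ : γ ∈ Gamma1 l) :
    σ * γ * σ⁻¹ ∈ Gamma1 l := by
  have hn : (Gamma1' l).Normal := MonoidHom.normal_ker _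
  have := hn.conj_mem ⟨γ, Gamma1_in_Gamma0 l hγ⟩ ((mem_Gamma1_iff _).1 hγ) ⟨σ, hσ⟩
  exact (mem_Gamma1_iff _).2 this

theorem T_mem_Gamma1 (l : ℕ) : ModularGroup.T ∈ Gamma1 l := by
  rw [Gamma1_mem]; simp [ModularGroup.T]

theorem conj_T_pow_mem_Gamma1 (l : ℕ) (σ : SL(2, ℤ)) :
    σ * ModularGroup.T ^ (l : ℤ) * σ⁻¹ ∈ Gamma1 l := by
  have h1 : ModularGroup.T ^ (l : ℤ) ∈ Gamma l := ModularGroup_T_pow_mem_Gamma l l dvd_rfl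
  have h2 := (Gamma_normal l).conj_mem _ h1 σ
  rw [Gamma_mem] at h2
  exact (Gamma1_mem l _).2 ⟨h2.1, h2.2.2.2, h2.2.2.1⟩

theorem slash_T_zpow (k : ℤ) (f : ℍ → ℂ) (n : ℤ) (τ : ℍ) :
    (f ∣[k] (ModularGroup.T ^ n)) τ = f ((n : ℝ) +ᵥ τ) := by
  rw [ModularForm.SL_slash_apply, modular_T_zpow_smul, ModularGroup.denom_apply]
  simp [ModularGroup.coe_T_zpow, -map_zpow]

theorem periodic_comp_ofComplex {f : ℍ → ℂ} {x : ℝ} (hf : ∀ τ : ℍ, f (x +ᵥ τ) = f τ) :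
    Function.Periodic (f ∘ ofComplex) x := by
  intro w
  by_cases hw : 0 < w.im
  · have hw' : 0 < (w + x).im := by simpa using hw
    rw [Function.comp_apply, Function.comp_apply, ofComplex_apply_of_im_pos hw,
      ofComplex_apply_of_im_pos hw', ← hf ⟨w, hw⟩]
    congr 1
    ext
    simp [add_comm]
  · have hw' : (w + x).im ≤ 0 := by simpa using hw
    exact comp_ofComplex_of_im_le_zero _ _ _ hw' (not_lt.1 hw)

theorem norm_petersson_self (k : ℤ) (f : ℍ → ℂ) (τ : ℍ) :
    ‖petersson k f f τ‖ = ‖f τ‖ ^ 2 * τ.im ^ k := by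
  rw [petersson, norm_mul, norm_mul, RCLike.norm_conj, sq, norm_zpow, Complex.norm_real,
    Real.norm_of_nonneg τ.im_pos.le]

namespace IsTwistedCuspForm

variable {l : ℕ} {h : CuspForm ((Gamma0 l).map (Matrix.SpecialLinearGroup.mapGL ℝ)) 2}
  {k : ℤ} {g : ℍ → ℂ} (hg : IsTwistedCuspForm l h k g)

include hg

theorem slash_of_mem {γ : SL(2, ℤ)} (hγ : γ ∈ Gamma1 l) :
    g ∣[k] γ = (cuspPhase h (γ 1 0) (γ 1 1))⁻¹ • g := by
  ext τ
  have hd : denom γ τ ≠ 0 := denom_ne_zero _ _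
  rw [ModularForm.SL_slash_apply, hg.map_smul γ hγ τ, Complex.exp_neg, ← cuspPhase,
    ← ModularGroup.denom_apply, Pi.smul_apply, smul_eq_mul, zpow_neg]
  field_simp

/-- The phase is trivial on parabolic elements, so translation brings no twist and ordinary Fourier
expansions are available. -/
theorem slash_vadd [NeZero l] {σ : SL(2, ℤ)} {n : ℤ}
    (hσ : σ * ModularGroup.T ^ n * σ⁻¹ ∈ Gamma1 l) (τ : ℍ) :
    (g ∣[k] σ) ((n : ℝ) +ᵥ τ) = (g ∣[k] σ) τ := by
  have h1 := hg.slash_of_mem hσ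
  rw [cuspPhase, reCuspValue_conj_T_zpow h σ n (Gamma1_in_Gamma0 l hσ)] at h1
  simp only [Complex.ofReal_zero, mul_zero, Complex.exp_zero, inv_one, one_smul] at h1
  rw [← slash_T_zpow k (g ∣[k] σ) n τ, ← SlashAction.slash_mul]
  conv_rhs => rw [← h1, ← SlashAction.slash_mul]
  rw [inv_mul_cancel_right]

theorem mdifferentiable_slash (σ : SL(2, ℤ)) : MDifferentiable 𝓘(ℂ) 𝓘(ℂ) (g ∣[k] σ) :=
  hg.holo.slash k (σ : GL (Fin 2) ℝ)

theorem exp_decay [NeZero l] (σ : SL(2, ℤ)) :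
    (g ∣[k] σ) =O[atImInfty] fun τ => Real.exp (-2 * Real.pi * τ.im / (l : ℝ)) :=
  (hg.vanishing σ).exp_decay_atImInfty (by have := NeZero.pos l; positivity)
    (periodic_comp_ofComplex fun τ => by
      simpa using hg.slash_vadd (conj_T_pow_mem_Gamma1 l σ) τ)
    (hg.mdifferentiable_slash σ) (hg.vanishing σ).isBoundedAtImInfty

theorem norm_petersson_smul {γ : SL(2, ℤ)} (hγ : γ ∈ Gamma1 l) (τ : ℍ) :
    ‖petersson k g g (γ • τ)‖ = ‖petersson k g g τ‖ := by
  rw [← petersson_slash_SL, hg.slash_of_mem hγ, norm_petersson_self, norm_petersson_self,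
    Pi.smul_apply, norm_smul, norm_inv, norm_cuspPhase, inv_one, one_mul]

/-- The phase has modulus one, so `|g|² y^k` is invariant under `Γ₁(l)`. It tends to `0` at every
cusp by exponential decay, hence is bounded. -/
theorem exists_petersson_bound [NeZero l] : ∃ C, ∀ τ, ‖g τ‖ ^ 2 * τ.im ^ k ≤ C := by
  have hl : 0 < (l : ℝ) := by have := NeZero.pos l; positivity
  have hbdd : ∀ σ : SL(2, ℤ), IsBoundedAtImInfty fun τ => ‖petersson k g g (σ • τ)‖ := by
    intro σ
    refine IsZeroAtImInfty.isBoundedAtImInfty ?_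
    simp_rw [← petersson_slash_SL, norm_petersson_self]
    have h1 : Tendsto (fun y : ℝ => Real.exp (-2 * Real.pi * y / l) ^ 2 * y ^ k) atTop (𝓝 0) := by
      have := tendsto_rpow_mul_exp_neg_mul_atTop_nhds_zero k (4 * Real.pi / l) (by positivity)
      refine this.congr fun y => ?_
      rw [mul_comm, Real.rpow_intCast, ← Real.exp_nat_mul]
      congr 2
      push_cast
      ring
    exact (((hg.exp_decay σ).norm_left.pow 2).mul
      (Asymptotics.isBigO_refl (fun τ : ℍ => τ.im ^ k) _)).trans_tendsto
      (h1.comp (tendsto_comap (f := UpperHalfPlane.im) (x := atTop)))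
  obtain ⟨C, hC⟩ := ModularGroup.exists_bound_of_subgroup_invariant
    (f := fun τ => ‖petersson k g g τ‖) (Γ := (Gamma1 l).map (Matrix.SpecialLinearGroup.mapGL ℝ))
    (petersson_continuous k hg.holo.continuous hg.holo.continuous).norm hbdd (by
      rintro _ ⟨γ, hγ, rfl⟩ τ
      exact hg.norm_petersson_smul hγ τ)
  refine ⟨C, fun τ => ?_⟩
  have := hC τ
  rwa [norm_norm, norm_petersson_self] at this

end IsTwistedCuspForm

/-- High up, decay like `e^{-2πy}` absorbs `y^{k/2} e^y`. Below height `A` the Petersson bound gives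
`y^{-k/2}`, at the cost of a factor `e^A`. -/
theorem exists_exp_bound {f : ℍ → ℂ} {k : ℤ} {C : ℝ} (hC : ∀ τ, ‖f τ‖ ^ 2 * τ.im ^ k ≤ C)
    (hdecay : f =O[atImInfty] fun τ => Real.exp (-2 * Real.pi * τ.im / 1)) :
    ∃ K, ∀ τ, ‖f τ‖ ≤ K * τ.im ^ (-(k / 2 : ℝ)) * Real.exp (-τ.im) := by
  have h1 : Tendsto (fun y : ℝ => Real.exp (-2 * Real.pi * y / 1) * (y ^ (k / 2 : ℝ) * Real.exp y))
      atTop (𝓝 0) := by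
    have := tendsto_rpow_mul_exp_neg_mul_atTop_nhds_zero (k / 2 : ℝ) (2 * Real.pi - 1)
      (by linarith [Real.pi_gt_three])
    refine this.congr fun y => ?_
    rw [mul_left_comm, ← Real.exp_add]
    congr 2
    ring
  have h2 : Tendsto (fun τ : ℍ => ‖f τ‖ * (τ.im ^ (k / 2 : ℝ) * Real.exp τ.im)) atImInfty (𝓝 0) :=
    (hdecay.norm_left.mul
      (Asymptotics.isBigO_refl (fun τ : ℍ => τ.im ^ (k / 2 : ℝ) * Real.exp τ.im) _)).trans_tendsto
      (h1.comp (tendsto_comap (f := UpperHalfPlane.im) (x := atTop)))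
  obtain ⟨A, hA⟩ := (atImInfty_mem _).1 (h2.eventually (eventually_le_nhds one_pos))
  have h3 : ∀ τ, ‖f τ‖ * (τ.im ^ (k / 2 : ℝ) * Real.exp τ.im) ≤
      max 1 (Real.sqrt C * Real.exp A) := by
    intro τ
    rcases le_total A τ.im with h | h
    · exact (hA τ h).trans (le_max_left _ _)
    · refine le_trans ?_ (le_max_right _ _)
      rw [← mul_assoc]
      gcongr
      refine Real.le_sqrt_of_sq_le ((le_of_eq ?_).trans (hC τ))
      rw [mul_pow, ← Real.rpow_natCast (τ.im ^ (k / 2 : ℝ)), ← Real.rpow_mul τ.im_pos.le]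
      congr 1
      rw [← Real.rpow_intCast]
      congr 1
      push_cast
      ring
  refine ⟨max 1 (Real.sqrt C * Real.exp A), fun τ => ?_⟩
  have hpos : 0 < τ.im ^ (k / 2 : ℝ) := Real.rpow_pos_of_pos τ.im_pos _
  rw [Real.rpow_neg τ.im_pos.le, Real.exp_neg, mul_assoc, ← mul_inv, ← div_eq_mul_inv,
    le_div_iff₀ (by positivity)]
  exact h3 τ

/-! ### Integration over the strip `0 ≤ x < 1`. -/

/-- The coordinates `(x, y)` of `x + i y`. -/
def coords (τ : ℍ) : ℝ × ℝ := (τ.re, τ.im)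

theorem measurableEmbedding_coords : MeasurableEmbedding coords :=
  Complex.measurableEquivRealProd.measurableEmbedding.comp measurableEmbedding_coe

theorem map_coords : (volume.comap UpperHalfPlane.coe).map coords =
    volume.restrict (Set.univ ×ˢ Set.Ioi (0 : ℝ)) := by
  have h1 : coords = Complex.measurableEquivRealProd ∘ UpperHalfPlane.coe := rfl
  rw [h1, ← Measure.map_map Complex.measurableEquivRealProd.measurable measurable_coe,
    measurableEmbedding_coe.map_comap]
  have h2 : Set.range UpperHalfPlane.coe =
      Complex.measurableEquivRealProd ⁻¹' (Set.univ ×ˢ Set.Ioi (0 : ℝ)) := by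
    ext z
    simp [Complex.measurableEquivRealProd]
  rw [h2, ← Measure.restrict_map Complex.measurableEquivRealProd.measurable
    (MeasurableSet.univ.prod measurableSet_Ioi),
    Complex.volume_preserving_equiv_real_prod.map_eq]

theorem volume_eq_withDensity_coords :
    (volume : Measure ℍ) = (volume.comap UpperHalfPlane.coe).withDensity
      fun z => (((1 / NNReal.mk z.im z.im_pos.le : NNReal) ^ 2 : NNReal) : ENNReal) := rfl

theorem measurable_density :
    Measurable fun z : ℍ => (1 / NNReal.mk z.im z.im_pos.le : NNReal) ^ 2 := by
  have : Measurable fun z : ℍ => NNReal.mk z.im z.im_pos.le :=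
    (UpperHalfPlane.continuous_im.measurable).subtype_mk
  exact (measurable_const.div this).pow_const 2

theorem integrable_comp_coords_iff (Ψ : ℝ × ℝ → ℂ) :
    Integrable (fun τ : ℍ => Ψ (coords τ)) ↔
      IntegrableOn (fun p : ℝ × ℝ => ((p.2 ^ 2)⁻¹ : ℝ) • Ψ p) (Set.univ ×ˢ Set.Ioi (0 : ℝ)) := by
  rw [IntegrableOn, ← map_coords, measurableEmbedding_coords.integrable_map_iff,
    volume_eq_withDensity_coords, integrable_withDensity_iff_integrable_smul measurable_density]
  refine integrable_congr (Eventually.of_forall fun τ => ?_)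
  simp [coords, NNReal.smul_def]

theorem integral_comp_coords (Ψ : ℝ × ℝ → ℂ) :
    ∫ τ : ℍ, Ψ (coords τ) =
      ∫ p in Set.univ ×ˢ Set.Ioi (0 : ℝ), ((p.2 ^ 2)⁻¹ : ℝ) • Ψ p := by
  rw [← map_coords, measurableEmbedding_coords.integral_map,
    volume_eq_withDensity_coords, integral_withDensity_eq_integral_smul measurable_density]
  refine integral_congr_ae (Eventually.of_forall fun τ => ?_)
  simp [coords, NNReal.smul_def]

/-- The strip `0 ≤ Re τ < 1`. -/
def strip : Set ℍ := {τ | τ.re ∈ Set.Ico (0 : ℝ) 1}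

theorem strip_indicator_eq (ψ : ℍ → ℂ) : strip.indicator ψ = fun τ =>
    (Set.Ico (0 : ℝ) 1 ×ˢ Set.Ioi (0 : ℝ)).indicator
      (fun p : ℝ × ℝ => ψ (verticalPoint p.1 p.2)) (coords τ) := by
  ext τ
  have hv : verticalPoint τ.re τ.im = τ := by
    ext
    rw [coe_verticalPoint _ τ.im_pos, ← coe_re, ← coe_im, Complex.re_add_im]
  by_cases hτ : τ ∈ strip
  · rw [Set.indicator_of_mem hτ,
      Set.indicator_of_mem (show coords τ ∈ Set.Ico (0 : ℝ) 1 ×ˢ Set.Ioi (0 : ℝ) from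
      ⟨hτ, τ.im_pos⟩)]
    exact congrArg ψ hv.symm
  · rw [Set.indicator_of_notMem hτ, Set.indicator_of_notMem fun h => hτ h.1]

theorem smul_indicator_eq (ψ : ℍ → ℂ) :
    (fun p : ℝ × ℝ => ((p.2 ^ 2)⁻¹ : ℝ) • (Set.Ico (0 : ℝ) 1 ×ˢ Set.Ioi (0 : ℝ)).indicator
      (fun p : ℝ × ℝ => ψ (verticalPoint p.1 p.2)) p) =
    (Set.Ico (0 : ℝ) 1 ×ˢ Set.Ioi (0 : ℝ)).indicator
      fun p : ℝ × ℝ => ((p.2 ^ 2)⁻¹ : ℝ) • ψ (verticalPoint p.1 p.2) := by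
  ext p
  by_cases hp : p ∈ Set.Ico (0 : ℝ) 1 ×ˢ Set.Ioi (0 : ℝ)
  · rw [Set.indicator_of_mem hp, Set.indicator_of_mem hp]
  · rw [Set.indicator_of_notMem hp, Set.indicator_of_notMem hp, smul_zero]

theorem measurableSet_strip_coords : MeasurableSet (Set.Ico (0 : ℝ) 1 ×ˢ Set.Ioi (0 : ℝ)) :=
  measurableSet_Ico.prod measurableSet_Ioi

theorem strip_coords_inter : (Set.Ico (0 : ℝ) 1 ×ˢ Set.Ioi (0 : ℝ)) ∩ (Set.univ ×ˢ Set.Ioi (0 : ℝ))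
    = Set.Ico (0 : ℝ) 1 ×ˢ Set.Ioi (0 : ℝ) :=
  Set.inter_eq_left.2 (Set.prod_mono (Set.subset_univ _) subset_rfl)

theorem integrable_strip_indicator_iff (ψ : ℍ → ℂ) :
    Integrable (strip.indicator ψ) ↔
      IntegrableOn (fun p : ℝ × ℝ => ((p.2 ^ 2)⁻¹ : ℝ) • ψ (verticalPoint p.1 p.2))
        (Set.Ico (0 : ℝ) 1 ×ˢ Set.Ioi (0 : ℝ)) := by
  rw [strip_indicator_eq, integrable_comp_coords_iff, smul_indicator_eq, IntegrableOn,
    integrable_indicator_iff measurableSet_strip_coords, IntegrableOn,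
    Measure.restrict_restrict measurableSet_strip_coords, strip_coords_inter,
    IntegrableOn]

theorem integral_strip_indicator (ψ : ℍ → ℂ) :
    ∫ τ, strip.indicator ψ τ =
      ∫ p in Set.Ico (0 : ℝ) 1 ×ˢ Set.Ioi (0 : ℝ),
        ((p.2 ^ 2)⁻¹ : ℝ) • ψ (verticalPoint p.1 p.2) := by
  rw [strip_indicator_eq, integral_comp_coords, smul_indicator_eq,
    integral_indicator measurableSet_strip_coords,
    Measure.restrict_restrict measurableSet_strip_coords, strip_coords_inter]

/-- The integral is the zeroth Fourier coefficient, which is the value at `i∞`. -/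
theorem intervalIntegral_eq_zero {f : ℍ → ℂ} (hper : Function.Periodic (f ∘ ofComplex) (1 : ℝ))
    (hhol : MDifferentiable 𝓘(ℂ) 𝓘(ℂ) f) (hzero : IsZeroAtImInfty f) {y : ℝ} (hy : 0 < y) :
    ∫ x in Set.Ico (0 : ℝ) 1, f (verticalPoint x y) = 0 := by
  have h1 := qExpansion_coeff_eq_intervalIntegral one_pos hper hhol hzero.isBoundedAtImInfty 0 hy
  rw [qExpansion_coeff_zero one_pos
    (analyticAt_cuspFunction_zero one_pos hper hhol hzero.isBoundedAtImInfty) hper,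
    hzero.valueAtInfty_eq_zero] at h1
  rw [integral_Ico_eq_integral_Ioo, ← integral_Ioc_eq_integral_Ioo,
    ← intervalIntegral.integral_of_le zero_le_one]
  simp only [Complex.ofReal_one, pow_zero, div_one, one_mul] at h1
  rw [h1]
  refine intervalIntegral.integral_congr fun x _ => ?_
  congr 1
  ext
  rw [coe_verticalPoint x hy]
  rfl

theorem integrable_and_integral_strip {f : ℍ → ℂ} {k : ℤ} (hk : 3 ≤ k)
    (hper : Function.Periodic (f ∘ ofComplex) (1 : ℝ))
    (hhol : MDifferentiable 𝓘(ℂ) 𝓘(ℂ) f) (hzero : IsZeroAtImInfty f)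
    {C : ℝ} (hC : ∀ τ, ‖f τ‖ ^ 2 * τ.im ^ k ≤ C) :
    Integrable (strip.indicator fun τ => (starRingEnd ℂ) (f τ) * (τ.im : ℂ) ^ k) ∧
      ∫ τ, strip.indicator (fun τ => (starRingEnd ℂ) (f τ) * (τ.im : ℂ) ^ k) τ = 0 := by
  have hint : IntegrableOn (fun p : ℝ × ℝ => ((p.2 ^ 2)⁻¹ : ℝ) •
      ((starRingEnd ℂ) (f (verticalPoint p.1 p.2)) * ((verticalPoint p.1 p.2).im : ℂ) ^ k))
        (Set.Ico (0 : ℝ) 1 ×ˢ Set.Ioi (0 : ℝ)) := by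
    obtain ⟨K, hK⟩ := exists_exp_bound hC
      (hzero.exp_decay_atImInfty one_pos hper hhol hzero.isBoundedAtImInfty)
    have hk' : (3 : ℝ) ≤ k := by exact_mod_cast hk
    -- Against `y^{k-2} dx dy` the bound `y^{-k/2} e^{-y}` becomes `y^{k/2-2} e^{-y}`, the integrand
    -- of `Γ(k/2 - 1)`; convergence near the real axis needs `k > 2`.
    have hb := (Real.GammaIntegral_convergent (s := k / 2 - 1) (by linarith)).const_mul K
    have hb2 : IntegrableOn (fun p : ℝ × ℝ => K * (Real.exp (-p.2) * p.2 ^ ((k / 2 - 1 : ℝ) - 1)))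
        (Set.Ico (0 : ℝ) 1 ×ˢ Set.Ioi (0 : ℝ)) := by
      rw [IntegrableOn, Measure.volume_eq_prod, ← Measure.prod_restrict]
      exact hb.comp_snd _
    refine Integrable.mono' hb2 ?_ ?_
    · refine ContinuousOn.aestronglyMeasurable ?_ measurableSet_strip_coords
      have hv : ContinuousOn (fun p : ℝ × ℝ => verticalPoint p.1 p.2)
          (Set.Ico (0 : ℝ) 1 ×ˢ Set.Ioi (0 : ℝ)) := by
        refine ContinuousOn.comp (t := {z : ℂ | 0 < z.im}) (g := ofComplex) ?_ (by fun_prop)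
          fun p hp => by simpa using hp.2
        exact fun z hz => (contMDiffAt_ofComplex (n := 1) hz).continuousAt.continuousWithinAt
      refine ContinuousOn.smul (f := fun p : ℝ × ℝ => (p.2 ^ 2)⁻¹) ?_ (ContinuousOn.mul ?_ ?_)
      · exact ContinuousOn.inv₀ (f := fun p : ℝ × ℝ => p.2 ^ 2) (by fun_prop) fun p hp =>
          pow_ne_zero _ (ne_of_gt hp.2)
      · exact Complex.continuous_conj.comp_continuousOn (hhol.continuous.comp_continuousOn hv)
      · exact (Complex.continuous_ofReal.comp_continuousOn
          (UpperHalfPlane.continuous_im.comp_continuousOn hv)).zpow₀ k fun p _ => Or.inl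
            (Complex.ofReal_ne_zero.2 (verticalPoint p.1 p.2).im_ne_zero)
    · refine (ae_restrict_iff' measurableSet_strip_coords).2 (Eventually.of_forall fun p hp => ?_)
      have hy : 0 < p.2 := hp.2
      have := hK (verticalPoint p.1 p.2)
      rw [im_verticalPoint _ hy] at this ⊢
      rw [norm_smul, norm_mul, RCLike.norm_conj, norm_zpow, Complex.norm_real,
        Real.norm_of_nonneg hy.le, Real.norm_of_nonneg (by positivity)]
      calc (p.2 ^ 2)⁻¹ * (‖f (verticalPoint p.1 p.2)‖ * p.2 ^ k)
          ≤ (p.2 ^ 2)⁻¹ * ((K * p.2 ^ (-(k / 2 : ℝ)) * Real.exp (-p.2)) * p.2 ^ k) := by gcongr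
        _ = K * (Real.exp (-p.2) * (p.2 ^ (-(k / 2 : ℝ)) * p.2 ^ (k : ℝ) * p.2 ^ (-2 : ℝ))) := by
          rw [Real.rpow_intCast, Real.rpow_neg hy.le 2, Real.rpow_two]
          ring
        _ = K * (Real.exp (-p.2) * p.2 ^ ((k / 2 - 1 : ℝ) - 1)) := by
          rw [← Real.rpow_add hy, ← Real.rpow_add hy]
          congr 3
          ring
  refine ⟨(integrable_strip_indicator_iff _).2 hint, ?_⟩
  rw [IntegrableOn, Measure.volume_eq_prod, ← Measure.prod_restrict] at hint
  rw [integral_strip_indicator, Measure.volume_eq_prod, ← Measure.prod_restrict,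
    integral_prod_symm _ hint]
  refine (setIntegral_congr_fun measurableSet_Ioi (g := fun _ => 0) fun y hy => ?_).trans (by simp)
  have hy : 0 < y := hy
  have h0 := intervalIntegral_eq_zero hper hhol hzero hy
  simp only [im_verticalPoint _ hy]
  rw [integral_smul, integral_mul_const, integral_conj, h0]
  simp

/-! ### Unfolding, and the passage from `Γ` to its group of transformations. -/

/-- Unfolding over a fundamental domain. -/
theorem integrableOn_tsum_smul {G α : Type*} [Group G] [Countable G] [MulAction G α]
    [MeasurableSpace α] [MeasurableConstSMul G α] {μ : Measure α} [SMulInvariantMeasure G α μ]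
    {D : Set α} (hD : IsFundamentalDomain G D μ) {Ψ : α → ℂ} (hm : Measurable Ψ)
    (hΨ : Integrable Ψ μ) :
    IntegrableOn (fun x => ∑' g : G, Ψ (g • x)) D μ ∧
      ∫ x in D, ∑' g : G, Ψ (g • x) ∂μ = ∫ x, Ψ x ∂μ := by
  have hm' : ∀ g : G, Measurable fun x => Ψ (g • x) := fun g => hm.comp (measurable_const_smul g)
  -- Unfolding `‖Ψ‖` itself bounds the sum of the norms, which gives both integrability and the
  -- exchange of sum and integral.
  have hfin : ∑' g : G, ∫⁻ x in D, ‖Ψ (g • x)‖ₑ ∂μ ≠ ⊤ := by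
    rw [← hD.lintegral_eq_tsum'' (fun x => ‖Ψ x‖ₑ)]
    exact hΨ.2.ne
  refine ⟨⟨(Measurable.tsum hm').aestronglyMeasurable, ?_⟩, ?_⟩
  · rw [HasFiniteIntegral]
    calc ∫⁻ x in D, ‖∑' g : G, Ψ (g • x)‖ₑ ∂μ
        ≤ ∫⁻ x in D, ∑' g : G, ‖Ψ (g • x)‖ₑ ∂μ := lintegral_mono fun x => enorm_tsum_le_tsum_enorm
      _ = ∑' g : G, ∫⁻ x in D, ‖Ψ (g • x)‖ₑ ∂μ :=
        lintegral_tsum fun g => (hm' g).enorm.aemeasurable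
      _ < ⊤ := hfin.lt_top
  · rw [integral_tsum (fun g => (hm' g).aestronglyMeasurable) hfin, ← hD.integral_eq_tsum'' _ hΨ]

/-- A surjective group homomorphism with kernel `K` identifies its source with `K × G`. -/
noncomputable def kerProdEquiv {Γ G : Type*} [Group Γ] [Group G] (π : Γ →* G)
    (hπ : Function.Surjective π) : π.ker × G ≃ Γ where
  toFun p := p.1 * Function.surjInv hπ p.2
  invFun γ := (⟨γ * (Function.surjInv hπ (π γ))⁻¹, by
    rw [MonoidHom.mem_ker, map_mul, map_inv, Function.surjInv_eq hπ, mul_inv_cancel]⟩, π γ)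
  left_inv p := by
    have h : π (p.1 * Function.surjInv hπ p.2) = p.2 := by
      rw [map_mul, Function.surjInv_eq hπ, (MonoidHom.mem_ker).1 p.1.2, one_mul]
    ext
    · simp only [h, mul_inv_cancel_right]
    · exact h
  right_inv γ := by simp

/-- All fibres of `π` have the size of the kernel. No summability is needed: without it both sums
take the default value `0`. -/
theorem tsum_comp_eq_card_ker_mul {Γ G : Type*} [Group Γ] [Group G] (π : Γ →* G)
    (hπ : Function.Surjective π) [Finite π.ker] (φ : G → ℂ) :
    ∑' γ, φ (π γ) = (Nat.card π.ker : ℂ) * ∑' g, φ g := by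
  have := Fintype.ofFinite π.ker
  rw [← (kerProdEquiv π hπ).tsum_eq]
  have h1 : ∀ p : π.ker × G, φ (π (kerProdEquiv π hπ p)) = φ p.2 := fun p => by
    congr 1
    exact congrArg Prod.snd ((kerProdEquiv π hπ).symm_apply_apply p)
  simp_rw [h1]
  by_cases hs : Summable φ
  · have h2 : Summable fun p : π.ker × G => φ p.2 := by
      refine Summable.of_norm ?_
      exact (summable_prod_of_nonneg fun _ => norm_nonneg _).2
        ⟨fun _ => hs.norm, Summable.of_finite⟩
    rw [h2.tsum_prod, tsum_fintype]
    simp only [Finset.sum_const, Finset.card_univ, Nat.card_eq_fintype_card,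
      nsmul_eq_mul]
  · have h2 : ¬ Summable fun p : π.ker × G => φ p.2 := fun h =>
      hs (h.comp_injective (i := fun g => (1, g)) fun a b hab => congrArg Prod.snd hab)
    rw [tsum_eq_zero_of_not_summable hs, tsum_eq_zero_of_not_summable h2, mul_zero]

theorem two_mul_I_mem_fdo : (⟨2 * Complex.I, by simp⟩ : ℍ) ∈ ModularGroup.fdo := by
  constructor
  · norm_num [Complex.normSq_apply]
  · simp [← coe_re]

/-- The point `2i` lies in the open standard fundamental domain, where only `±1` can keep a point
inside. -/
theorem eq_one_or_neg_one_of_smul_eq {γ : SL(2, ℤ)} (h : ∀ τ : ℍ, γ • τ = τ) :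
    γ = 1 ∨ γ = -1 :=
  ModularGroup.eq_one_or_neg_one_of_mem_fdo_mem_fdo two_mul_I_mem_fdo
    (by rw [h]; exact two_mul_I_mem_fdo)

/-- The homomorphism from `Γ` onto the group of transformations it induces. -/
noncomputable def toTransformations (Γ : Subgroup SL(2, ℤ)) : Γ →* transformations Γ :=
  (MulAction.toPermHom SL(2, ℤ) ℍ).subgroupMap Γ

theorem toTransformations_surjective (Γ : Subgroup SL(2, ℤ)) :
    Function.Surjective (toTransformations Γ) :=
  (MulAction.toPermHom SL(2, ℤ) ℍ).subgroupMap_surjective Γ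

theorem toTransformations_smul (Γ : Subgroup SL(2, ℤ)) (γ : Γ) (τ : ℍ) :
    toTransformations Γ γ • τ = (γ : SL(2, ℤ)) • τ := rfl

instance finite_ker_toTransformations (Γ : Subgroup SL(2, ℤ)) :
    Finite (toTransformations Γ).ker := by
  have : ∀ γ : (toTransformations Γ).ker, γ.1.1 ∈ ({1, -1} : Set SL(2, ℤ)) := fun γ => by
    have h := (MonoidHom.mem_ker).1 γ.2
    refine eq_one_or_neg_one_of_smul_eq fun τ => ?_
    rw [← toTransformations_smul, h, one_smul]
  exact Finite.of_injective (β := ({1, -1} : Set SL(2, ℤ))) (fun γ => ⟨γ.1.1, this γ⟩)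
    fun a b hab => Subtype.ext (Subtype.ext (show a.1.1 = b.1.1 from Subtype.mk.inj hab))

instance countable_SL2Z : Countable SL(2, ℤ) :=
  Function.Injective.countable (β := Fin 2 → Fin 2 → ℤ) (f := fun g i j => g i j)
    fun a b hab => by
      ext i j
      exact congrFun (congrFun hab i) j

instance countable_transformations (Γ : Subgroup SL(2, ℤ)) : Countable (transformations Γ) :=
  (toTransformations_surjective Γ).countable

theorem measurePreserving_SL_smul (γ : SL(2, ℤ)) :
    MeasurePreserving (fun τ : ℍ => γ • τ) volume volume :=
  ⟨(continuous_const_smul (Matrix.SpecialLinearGroup.mapGL ℝ γ)).measurable,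
    (measurePreserving_smul (Matrix.SpecialLinearGroup.mapGL ℝ γ) (volume : Measure ℍ)).map_eq⟩

instance measurableConstSMul_transformations (Γ : Subgroup SL(2, ℤ)) :
    MeasurableConstSMul (transformations Γ) ℍ :=
  ⟨fun c => by
    obtain ⟨γ, rfl⟩ := toTransformations_surjective Γ c
    exact (measurePreserving_SL_smul γ.1).measurable⟩

instance smulInvariantMeasure_transformations (Γ : Subgroup SL(2, ℤ)) :
    SMulInvariantMeasure (transformations Γ) ℍ volume :=
  ⟨fun c s hs => by
    obtain ⟨γ, rfl⟩ := toTransformations_surjective Γ c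
    exact (measurePreserving_SL_smul γ.1).measure_preimage hs.nullMeasurableSet⟩

/-- The sum over matrices counts each transformation once per element of the kernel, which lies in
`{1, -1}`; a constant factor does not affect the vanishing. -/
theorem integrableOn_tsum_smul_of_integral_eq_zero {Γ : Subgroup SL(2, ℤ)} {D : Set ℍ}
    (hD : IsFundDomain Γ D) {Ψ : ℍ → ℂ} (hm : Measurable Ψ) (hΨ : Integrable Ψ)
    (h0 : ∫ τ, Ψ τ = 0) :
    IntegrableOn (fun τ => ∑' γ : Γ, Ψ ((γ : SL(2, ℤ)) • τ)) D ∧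
      ∫ τ in D, ∑' γ : Γ, Ψ ((γ : SL(2, ℤ)) • τ) = 0 := by
  have h1 := integrableOn_tsum_smul hD hm hΨ
  have h2 : (fun τ => ∑' γ : Γ, Ψ ((γ : SL(2, ℤ)) • τ)) = fun τ =>
      (Nat.card (toTransformations Γ).ker : ℂ) * ∑' g : transformations Γ, Ψ (g • τ) := by
    ext τ
    rw [← tsum_comp_eq_card_ker_mul _ (toTransformations_surjective Γ)]
    rfl
  rw [h2]
  refine ⟨h1.1.const_mul _, ?_⟩
  rw [integral_const_mul, h1.2, h0, mul_zero]

/-! ### The Eisenstein series: convergence and parametrization by `Γ₀(l)`. -/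

theorem norm_eisensteinTerm (l : ℕ) (k i : ℤ) (h : ℍ → ℂ) (τ : ℍ) (p : EisensteinIndex l) :
    ‖eisensteinTerm l k i h τ p‖ = ‖EisensteinSeries.eisSummand k ![p.1.1, p.1.2] τ‖ := by
  have h1 : ‖Complex.exp (-(2 * Real.pi * Complex.I * ((p.1.2 : ℂ) * (i : ℂ) / (l : ℂ))))‖ = 1 := by
    rw [show -(2 * Real.pi * Complex.I * ((p.1.2 : ℂ) * (i : ℂ) / (l : ℂ))) =
      ((-(2 * Real.pi * (p.1.2 * i / l)) : ℝ) : ℂ) * Complex.I by push_cast; ring,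
      Complex.norm_exp_ofReal_mul_I]
  rw [eisensteinTerm, norm_mul, norm_mul, h1, ← cuspPhase, norm_cuspPhase, mul_one, mul_one,
    EisensteinSeries.eisSummand]
  simp

theorem summable_norm_eisensteinTerm (l : ℕ) {k : ℤ} (hk : 3 ≤ k) (i : ℤ) (h : ℍ → ℂ) (τ : ℍ) :
    Summable fun p => ‖eisensteinTerm l k i h τ p‖ := by
  simp_rw [norm_eisensteinTerm]
  refine (EisensteinSeries.summable_norm_eisSummand hk τ).comp_injective
    (i := fun p : EisensteinIndex l => ![p.1.1, p.1.2]) fun p q hpq => ?_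
  have h0 := congrFun hpq 0
  have h1 := congrFun hpq 1
  exact Subtype.ext (Prod.ext h0 h1)

/-- The positive integers prime to `l`. -/
def Multiplier (l : ℕ) : Type := {n : ℕ // 0 < n ∧ Nat.Coprime n l}

theorem gcd_lower_right {l : ℕ} {δ : SL(2, ℤ)} (hδ : δ ∈ Gamma0 l) : IsCoprime (l : ℤ) (δ 1 1) := by
  have hc : (l : ℤ) ∣ δ 1 0 := (ZMod.intCast_zmod_eq_zero_iff_dvd _ _).1 (Gamma0_mem.1 hδ)
  exact (ModularGroup.bottom_row_coprime δ).of_isCoprime_of_dvd_left hc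

/-- The bottom row of `δ` multiplied by `n`. -/
def toIndex (l : ℕ) (x : Multiplier l × Gamma0 l) : EisensteinIndex l :=
  ⟨((x.1.1 : ℤ) * (x.2 : SL(2, ℤ)) 1 0, (x.1.1 : ℤ) * (x.2 : SL(2, ℤ)) 1 1), by
    obtain ⟨⟨n, hn, hnl⟩, δ, hδ⟩ := x
    have hc : (l : ℤ) ∣ δ 1 0 := (ZMod.intCast_zmod_eq_zero_iff_dvd _ _).1 (Gamma0_mem.1 hδ)
    refine ⟨hc.mul_left _, ?_, fun h0 => ?_⟩
    · rw [← Int.isCoprime_iff_gcd_eq_one]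
      exact IsCoprime.mul_right (Nat.isCoprime_iff_coprime.2 hnl.symm) (gcd_lower_right hδ)
    · have hn' : (n : ℤ) ≠ 0 := by exact_mod_cast hn.ne'
      have h1 : δ 1 0 = 0 := (mul_eq_zero.1 (congrArg Prod.fst h0)).resolve_left hn'
      have h2 : δ 1 1 = 0 := (mul_eq_zero.1 (congrArg Prod.snd h0)).resolve_left hn'
      have := ModularGroup.bottom_row_coprime δ
      rw [h1, h2] at this
      exact not_isCoprime_zero_zero this⟩

theorem gcd_toIndex {l : ℕ} (x : Multiplier l × Gamma0 l) :
    Int.gcd (toIndex l x).1.1 (toIndex l x).1.2 = x.1.1 := by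
  have := Int.isCoprime_iff_gcd_eq_one.1 (ModularGroup.bottom_row_coprime x.2.1)
  simp only [toIndex, Int.gcd_mul_left, Int.natAbs_natCast]
  rw [this, mul_one]

theorem mul_inv_lower_left (A B : SL(2, ℤ)) : (A * B⁻¹) 1 0 = A 1 0 * B 1 1 - A 1 1 * B 1 0 := by
  rw [Matrix.SpecialLinearGroup.coe_mul, Matrix.SpecialLinearGroup.coe_inv,
    Matrix.adjugate_fin_two]
  simp [Matrix.mul_apply, sub_eq_add_neg]

theorem mul_inv_lower_right (A B : SL(2, ℤ)) : (A * B⁻¹) 1 1 = A 1 1 * B 0 0 - A 1 0 * B 0 1 := by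
  rw [Matrix.SpecialLinearGroup.coe_mul, Matrix.SpecialLinearGroup.coe_inv,
    Matrix.adjugate_fin_two]
  simp [Matrix.mul_apply]
  ring

/-- The gcd recovers `n`, and the bottom row then determines `δ` up to a power of `T` on the left. A
nontrivial power moves `δτ` out of the strip. -/
theorem toIndex_injOn (l : ℕ) (τ : ℍ) : Set.InjOn (toIndex l)
    {x | (x.2 : SL(2, ℤ)) • τ ∈ strip} := by
  rintro ⟨n, δ⟩ hx ⟨n', δ'⟩ hy hxy
  have hn : n = n' := Subtype.ext (by
    rw [← gcd_toIndex (n, δ), ← gcd_toIndex (n', δ'), hxy])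
  subst hn
  have hn0 : (n.1 : ℤ) ≠ 0 := by exact_mod_cast n.2.1.ne'
  have h0 : (δ : SL(2, ℤ)) 1 0 = (δ' : SL(2, ℤ)) 1 0 :=
    mul_left_cancel₀ hn0 (congrArg (fun p => p.1.1) hxy)
  have h1 : (δ : SL(2, ℤ)) 1 1 = (δ' : SL(2, ℤ)) 1 1 :=
    mul_left_cancel₀ hn0 (congrArg (fun p => p.1.2) hxy)
  have hg0 : ((δ' : SL(2, ℤ)) * (δ : SL(2, ℤ))⁻¹) 1 0 = 0 := by
    rw [mul_inv_lower_left, h0, h1]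
    ring
  have hg1 : ((δ' : SL(2, ℤ)) * (δ : SL(2, ℤ))⁻¹) 1 1 = 1 := by
    have hdet := Matrix.det_fin_two (δ : SL(2, ℤ)).1
    rw [(δ : SL(2, ℤ)).2] at hdet
    rw [mul_inv_lower_right, ← h0, ← h1]
    linarith
  obtain ⟨m, hm⟩ := ModularGroup.exists_eq_T_zpow_of_c_eq_zero hg0
  have hre : ((δ' : SL(2, ℤ)) • τ).re = ((δ : SL(2, ℤ)) • τ).re + m := by
    rw [← ModularGroup.re_T_zpow_smul, ← hm, mul_smul, inv_smul_smul]
  have hx' : ((δ : SL(2, ℤ)) • τ).re ∈ Set.Ico (0 : ℝ) 1 := hx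
  have hy' : ((δ' : SL(2, ℤ)) • τ).re ∈ Set.Ico (0 : ℝ) 1 := hy
  rw [hre] at hy'
  have hm0 : m = 0 := by
    have h1 : (m : ℝ) < 1 := by linarith [hx'.1, hy'.2]
    have h2 : (-1 : ℝ) < m := by linarith [hx'.2, hy'.1]
    have h3 : m < 1 := by exact_mod_cast h1
    have h4 : -1 < m := by exact_mod_cast h2
    omega
  -- The equality with a power of `T` is one of actions only, so the sign is still open; the lower
  -- right entry `1` excludes `-1`.
  have hg : (δ' : SL(2, ℤ)) * (δ : SL(2, ℤ))⁻¹ = 1 := by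
    refine (eq_one_or_neg_one_of_smul_eq fun z => ?_).resolve_right fun h => ?_
    · rw [hm, hm0, zpow_zero, one_smul]
    · rw [h] at hg1
      simp at hg1
  exact Prod.ext rfl (Subtype.ext (mul_inv_eq_one.1 hg).symm)

theorem exists_toIndex_eq (l : ℕ) [NeZero l] (τ : ℍ) (p : EisensteinIndex l) :
    ∃ x : Multiplier l × Gamma0 l, (x.2 : SL(2, ℤ)) • τ ∈ strip ∧ toIndex l x = p := by
  obtain ⟨⟨c, d⟩, hc, hd, hne⟩ := p
  have hpos : 0 < Int.gcd c d := by
    rw [Int.gcd_pos_iff]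
    by_contra! h
    exact hne (Prod.ext h.1 h.2)
  obtain ⟨c', d', hcop, hc', hd'⟩ := Int.exists_gcd_one hpos
  set n := Int.gcd c d with hn
  have hln : IsCoprime (l : ℤ) (n : ℤ) :=
    (Int.isCoprime_iff_gcd_eq_one.2 hd).of_isCoprime_of_dvd_right (hn ▸ Int.gcd_dvd_right c d)
  have hc1 : (l : ℤ) ∣ c' := by
    have : (l : ℤ) ∣ c' * n := hc' ▸ hc
    exact hln.dvd_of_dvd_mul_right this
  obtain ⟨δ, -, hδ⟩ := ModularGroup.bottom_row_surj
    (show ![c', d'] ∈ {cd : Fin 2 → ℤ | IsCoprime (cd 0) (cd 1)} from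
      Int.isCoprime_iff_gcd_eq_one.2 hcop)
  have hδ0 : δ 1 0 = c' := congrFun hδ 0
  have hδ1 : δ 1 1 = d' := congrFun hδ 1
  -- Left multiplication by `T ^ m` keeps the bottom row and translates `δτ` into the strip.
  set m : ℤ := -⌊(δ • τ).re⌋
  have hr0 : (ModularGroup.T ^ m * δ) 1 0 = c' := by
    simp [hδ0, -map_zpow]
  have hr1 : (ModularGroup.T ^ m * δ) 1 1 = d' := by
    simp [hδ1, -map_zpow]
  refine ⟨(⟨n, hpos, (Nat.isCoprime_iff_coprime.1 hln).symm⟩, ⟨ModularGroup.T ^ m * δ, ?_⟩), ?_, ?_⟩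
  · rw [Gamma0_mem, hr0]
    exact (ZMod.intCast_zmod_eq_zero_iff_dvd _ _).2 hc1
  · change ((ModularGroup.T ^ m * δ) • τ).re ∈ Set.Ico (0 : ℝ) 1
    rw [mul_smul, ModularGroup.re_T_zpow_smul]
    simp only [m, Int.cast_neg, ← sub_eq_add_neg]
    exact ⟨Int.fract_nonneg _, Int.fract_lt_one _⟩
  · refine Subtype.ext (Prod.ext ?_ ?_)
    · change (n : ℤ) * (ModularGroup.T ^ m * δ) 1 0 = c
      rw [hr0, mul_comm]
      exact hc'.symm
    · change (n : ℤ) * (ModularGroup.T ^ m * δ) 1 1 = d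
      rw [hr1, mul_comm]
      exact hd'.symm

/-- The factor of the `(n c, n d)` term depending on `n` and on `d` modulo `l`. -/
noncomputable def multiplierTerm (l : ℕ) (k i : ℤ) (d : ℤ) (n : Multiplier l) : ℂ :=
  (n.1 : ℂ) ^ (-k) * Complex.exp (-(2 * Real.pi * Complex.I * ((n.1 * d : ℂ) * (i : ℂ) / (l : ℂ))))

theorem multiplierTerm_congr {l : ℕ} [NeZero l] (k i : ℤ) {d d' : ℤ} (hd : (l : ℤ) ∣ d - d')
    (n : Multiplier l) : multiplierTerm l k i d n = multiplierTerm l k i d' n := by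
  obtain ⟨m, hm⟩ := hd
  have hl : (l : ℂ) ≠ 0 := NeZero.ne _
  rw [multiplierTerm, multiplierTerm]
  congr 1
  rw [Complex.exp_eq_exp_iff_exists_int]
  refine ⟨-(n.1 * m * i), ?_⟩
  have : (d : ℂ) = d' + l * m := by
    rw [sub_eq_iff_eq_add'] at hm
    rw [hm]; push_cast; ring
  rw [this]
  push_cast
  field_simp
  ring

/-- The phase sees only the cusp `-d/c`, so the multiplier `n` drops out of it. -/
theorem reCuspValue_mul_left (h : ℍ → ℂ) {n : ℤ} (hn : n ≠ 0) (c d : ℤ) :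
    reCuspValue h (n * c) (n * d) = reCuspValue h c d := by
  have hn' : (n : ℂ) ≠ 0 := by exact_mod_cast hn
  by_cases hc : c = 0
  · simp [reCuspValue, hc]
  · rw [reCuspValue, if_neg (mul_ne_zero hn hc), reCuspValue, if_neg hc]
    push_cast
    rw [mul_div_mul_left _ _ hn']

theorem eisensteinTerm_toIndex (l : ℕ) (k i : ℤ) (h : ℍ → ℂ) (τ : ℍ)
    (x : Multiplier l × Gamma0 l) :
    eisensteinTerm l k i h τ (toIndex l x) =
      multiplierTerm l k i ((x.2 : SL(2, ℤ)) 1 1) x.1 *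
        (denom (x.2 : SL(2, ℤ)) τ ^ (-k) *
          cuspPhase h ((x.2 : SL(2, ℤ)) 1 0) ((x.2 : SL(2, ℤ)) 1 1)) := by
  have hn0 : (x.1.1 : ℤ) ≠ 0 := by exact_mod_cast x.1.2.1.ne'
  simp only [eisensteinTerm, toIndex, multiplierTerm, ModularGroup.denom_apply]
  rw [reCuspValue_mul_left h hn0, ← cuspPhase]
  push_cast
  rw [mul_assoc (x.1.1 : ℂ) _ (τ : ℂ), ← mul_add, mul_zpow]
  ring

/-- The indicator picks, for the given `τ`, one representative of each coset of the translations in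
`Γ₀(l)`. This avoids a quotient and leaves a full sum over `Γ₀(l)`, ready to be split by cosets of
`Γ₁(l)`. -/
theorem hasSum_comp_toIndex (l : ℕ) [NeZero l] (τ : ℍ) {φ : EisensteinIndex l → ℂ}
    (hφ : Summable φ) :
    HasSum ({x : Multiplier l × Gamma0 l | (x.2 : SL(2, ℤ)) • τ ∈ strip}.indicator
      fun x => φ (toIndex l x)) (∑' p, φ p) := by
  let e : {x : Multiplier l × Gamma0 l | (x.2 : SL(2, ℤ)) • τ ∈ strip} ≃ EisensteinIndex l :=
    Equiv.ofBijective (fun x => toIndex l x.1)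
      ⟨fun x y hxy => Subtype.ext (toIndex_injOn l τ x.2 y.2 hxy), fun p => by
        obtain ⟨x, hx, hp⟩ := exists_toIndex_eq l τ p
        exact ⟨⟨x, hx⟩, hp⟩⟩
  rw [← hasSum_subtype_iff_indicator]
  exact (e.hasSum_iff (f := φ)).2 hφ.hasSum

/-! ### Splitting by cosets of `Γ₁(l)` and rewriting the Petersson integrand. -/

/-- A group is in bijection with the product of a coset space and the subgroup. -/
noncomputable def outMulEquiv {G : Type*} [Group G] (s : Subgroup G) : (G ⧸ s) × s ≃ G where
  toFun p := p.1.out * p.2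
  invFun g := ((g : G ⧸ s), ⟨(g : G ⧸ s).out⁻¹ * g, QuotientGroup.eq.1 (QuotientGroup.out_eq' _)⟩)
  left_inv p := by
    have h : ((p.1.out * (p.2 : G) : G) : G ⧸ s) = p.1 := by
      rw [QuotientGroup.mk_mul_of_mem _ p.2.2, QuotientGroup.out_eq']
    ext
    · exact h
    · simp [h]
  right_inv g := by simp

/-- `Γ₀(l)` as the product of `Γ₀(l)/Γ₁(l)` and `Γ₁(l)`. -/
noncomputable def cosetEquiv (l : ℕ) :
    (Gamma0 l ⧸ (Gamma1 l).subgroupOf (Gamma0 l)) × Gamma1 l ≃ Gamma0 l :=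
  ((Equiv.refl _).prodCongr
    (Subgroup.subgroupOfEquivOfLe (Gamma1_in_Gamma0 l)).symm.toEquiv).trans (outMulEquiv _)

/-- With `multiplierTerm_congr`, this makes the sum over `n` depend only on the coset, so that it
factors out of the sum over `Γ₁(l)`. -/
theorem dvd_lower_right_sub {l : ℕ} {σ γ : SL(2, ℤ)} (hσ : σ ∈ Gamma0 l) (hγ : γ ∈ Gamma1 l) :
    (l : ℤ) ∣ (σ * γ) 1 1 - σ 1 1 := by
  rw [← ZMod.intCast_eq_intCast_iff_dvd_sub, eq_comm]
  have h1 := Gamma0_mem.1 hσ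
  have h2 := (Gamma1_mem l _).1 hγ
  have h3 : (σ * γ) 1 1 = σ 1 0 * γ 0 1 + σ 1 1 * γ 1 1 := by
    simp [Matrix.mul_apply, Fin.sum_univ_two]
  rw [h3]
  push_cast
  rw [h1, h2.2.1]
  ring

theorem denom_mul_inv_smul (k : ℤ) (g : ℍ → ℂ) (δ : SL(2, ℤ)) (τ : ℍ) :
    (g ∣[k] δ⁻¹) (δ • τ) = g τ * denom δ τ ^ k := by
  have h1 : ((g ∣[k] δ⁻¹) ∣[k] δ) τ = g τ := by
    rw [← SlashAction.slash_mul, inv_mul_cancel, SlashAction.slash_one]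
  rw [ModularForm.SL_slash_apply] at h1
  rw [← h1, mul_assoc, ← zpow_add₀ (denom_ne_zero _ _)]
  simp

section Unfold

variable {l : ℕ} {h : CuspForm ((Gamma0 l).map (Matrix.SpecialLinearGroup.mapGL ℝ)) 2}
  {k : ℤ} {g : ℍ → ℂ}

/-- The function `conj (g ∣ σ⁻¹) y ^ k` on the strip `0 ≤ x < 1`. -/
noncomputable def stripFunction (k : ℤ) (g : ℍ → ℂ) (σ : SL(2, ℤ)) : ℍ → ℂ :=
  strip.indicator fun τ => (starRingEnd ℂ) ((g ∣[k] σ⁻¹) τ) * (τ.im : ℂ) ^ k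

/-- The phase of `σγ` splits; the part from `γ` is absorbed by the twisted automorphy of `g`, since
a unimodular number is the conjugate of its inverse. With `j` the denominator of `σγ`, the rest is
`Im(σγτ) = y / |j|²` and `|j|² = j · conj j`. -/
theorem IsTwistedCuspForm.denom_mul_phase (hg : IsTwistedCuspForm l h k g)
    {σ γ : SL(2, ℤ)} (hσ : σ ∈ Gamma0 l) (hγ : γ ∈ Gamma1 l) (τ : ℍ) :
    denom (σ * γ : SL(2, ℤ)) τ ^ (-k) * cuspPhase h ((σ * γ) 1 0) ((σ * γ) 1 1) *
        ((starRingEnd ℂ) (g τ) * (τ.im : ℂ) ^ k) =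
      cuspPhase h (σ 1 0) (σ 1 1) *
        ((starRingEnd ℂ) ((g ∣[k] σ⁻¹) ((σ * γ) • τ)) * ((((σ * γ) • τ).im : ℝ) : ℂ) ^ k) := by
  have h1 : g ∣[k] σ⁻¹ = (cuspPhase h (γ 1 0) (γ 1 1))⁻¹ • (g ∣[k] (σ * γ)⁻¹) := by
    rw [← ModularForm.SL_smul_slash, ← hg.slash_of_mem hγ, ← SlashAction.slash_mul]
    simp
  rw [cuspPhase_mul h hσ (Gamma1_in_Gamma0 l hγ), h1, Pi.smul_apply, smul_eq_mul]
  generalize σ * γ = δ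
  rw [map_mul (starRingEnd ℂ), conj_inv_cuspPhase, denom_mul_inv_smul,
    ModularGroup.im_smul_eq_div_normSq, map_mul (starRingEnd ℂ), map_zpow₀ (starRingEnd ℂ),
    Complex.ofReal_div, Complex.normSq_eq_conj_mul_self, div_zpow, mul_zpow, zpow_neg]
  have hd : denom (δ : GL (Fin 2) ℝ) τ ≠ 0 := denom_ne_zero _ _
  generalize denom (δ : GL (Fin 2) ℝ) τ = z at hd ⊢
  have hd' : (starRingEnd ℂ) z ≠ 0 := (map_ne_zero _).2 hd
  field_simp

/-- Because `Γ₁(l)` is normal in `Γ₀(l)`, the conjugate `σ⁻¹ T σ` stays in `Γ₁(l)`. Hence `g ∣ σ⁻¹`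
has period `1`, not merely `l`, and a strip of width one carries its constant term. -/
theorem IsTwistedCuspForm.stripFunction_spec [NeZero l] (hg : IsTwistedCuspForm l h k g)
    (hk : 3 ≤ k) {σ : SL(2, ℤ)} (hσ : σ ∈ Gamma0 l) :
    Measurable (stripFunction k g σ) ∧ Integrable (stripFunction k g σ) ∧
      ∫ τ, stripFunction k g σ τ = 0 := by
  have hσ' := (Gamma0 l).inv_mem hσ
  have hhol := hg.mdifferentiable_slash σ⁻¹
  obtain ⟨C, hC⟩ := hg.exists_petersson_bound
  have hstrip : MeasurableSet strip := measurableSet_Ico.preimage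
    (Complex.measurable_re.comp measurable_coe)
  have hcont : Continuous fun τ : ℍ =>
      (starRingEnd ℂ) ((g ∣[k] σ⁻¹) τ) * (τ.im : ℂ) ^ k :=
    (Complex.continuous_conj.comp hhol.continuous).mul
      ((Complex.continuous_ofReal.comp UpperHalfPlane.continuous_im).zpow₀ k fun τ =>
        Or.inl (Complex.ofReal_ne_zero.2 τ.im_ne_zero))
  refine ⟨hcont.measurable.indicator hstrip, integrable_and_integral_strip hk
    (periodic_comp_ofComplex fun τ => ?_) hhol (hg.vanishing σ⁻¹) (C := C) fun τ => ?_⟩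
  · have := hg.slash_vadd (σ := σ⁻¹) (n := 1)
      (by rw [zpow_one]; exact conj_mem_Gamma1 hσ' (T_mem_Gamma1 l)) τ
    simpa using this
  · rw [← norm_petersson_self, petersson_slash_SL, norm_petersson_self]
    exact hC _

/-- Absolute convergence allows the series to be regrouped by coset; within a coset it is a product
of a sum over `n` and a sum over `Γ₁(l)`, and the latter is rewritten by `denom_mul_phase`. -/
theorem IsTwistedCuspForm.peterssonIntegrand_eq [NeZero l] (hg : IsTwistedCuspForm l h k g)
    (hk : 3 ≤ k) (i : ℤ) [Fintype (Gamma0 l ⧸ (Gamma1 l).subgroupOf (Gamma0 l))] (τ : ℍ) :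
    peterssonIntegrand k (eisenstein l k i h) g τ =
      ∑ q : Gamma0 l ⧸ (Gamma1 l).subgroupOf (Gamma0 l),
        (∑' n, multiplierTerm l k i ((q.out : SL(2, ℤ)) 1 1) n) *
          cuspPhase h ((q.out : SL(2, ℤ)) 1 0) ((q.out : SL(2, ℤ)) 1 1) *
          ∑' γ : Gamma1 l, stripFunction k g q.out ((q.out : SL(2, ℤ)) • (γ : SL(2, ℤ)) • τ) := by
  classical
  let e : (Gamma0 l ⧸ (Gamma1 l).subgroupOf (Gamma0 l)) × (Multiplier l × Gamma1 l) ≃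
      Multiplier l × Gamma0 l :=
    { toFun := fun p => (p.2.1, cosetEquiv l (p.1, p.2.2))
      invFun := fun x => (((cosetEquiv l).symm x.2).1, (x.1, ((cosetEquiv l).symm x.2).2))
      left_inv := fun p => by simp
      right_inv := fun x => by simp }
  set B : (Gamma0 l ⧸ (Gamma1 l).subgroupOf (Gamma0 l)) → Gamma1 l → ℂ := fun q γ =>
    {γ : Gamma1 l | ((q.out : SL(2, ℤ)) * (γ : SL(2, ℤ))) • τ ∈ strip}.indicator (fun γ =>
      denom ((q.out : SL(2, ℤ)) * (γ : SL(2, ℤ)) : SL(2, ℤ)) τ ^ (-k) *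
        cuspPhase h (((q.out : SL(2, ℤ)) * (γ : SL(2, ℤ))) 1 0)
          (((q.out : SL(2, ℤ)) * (γ : SL(2, ℤ))) 1 1)) γ with hB
  have h1 := hasSum_comp_toIndex l τ (summable_norm_eisensteinTerm l hk i h τ).of_norm
  rw [← e.hasSum_iff] at h1
  have h2 : ∀ p, ({x : Multiplier l × Gamma0 l | (x.2 : SL(2, ℤ)) • τ ∈ strip}.indicator
      (fun x => eisensteinTerm l k i h τ (toIndex l x)) ∘ e) p =
        multiplierTerm l k i ((p.1.out : SL(2, ℤ)) 1 1) p.2.1 * B p.1 p.2.2 := by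
    rintro ⟨q, n, γ⟩
    have hmul := multiplierTerm_congr k i (dvd_lower_right_sub q.out.2 γ.2) n
    simp only [Function.comp_apply, Set.indicator, hB, Set.mem_ofPred_eq, eisensteinTerm_toIndex]
    change (if ((q.out : SL(2, ℤ)) * (γ : SL(2, ℤ))) • τ ∈ strip then
      multiplierTerm l k i (((q.out : SL(2, ℤ)) * (γ : SL(2, ℤ))) 1 1) n * _ else 0) = _
    rw [hmul, mul_ite, mul_zero]
    rfl
  have h3 : HasSum (fun p : (Gamma0 l ⧸ (Gamma1 l).subgroupOf (Gamma0 l)) ×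
      (Multiplier l × Gamma1 l) =>
        multiplierTerm l k i ((p.1.out : SL(2, ℤ)) 1 1) p.2.1 * B p.1 p.2.2)
      (eisenstein l k i h τ) := by
    rwa [← funext h2]
  rw [peterssonIntegrand, ← h3.tsum_eq, h3.summable.tsum_prod, tsum_fintype, mul_assoc,
    Finset.sum_mul]
  refine Finset.sum_congr rfl fun q _ => ?_
  rw [(h3.summable.prod_factor q).tsum_prod]
  simp only [tsum_mul_left, tsum_mul_right]
  have h4 : (∑' γ, B q γ) * ((starRingEnd ℂ) (g τ) * (τ.im : ℂ) ^ k) =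
      cuspPhase h ((q.out : SL(2, ℤ)) 1 0) ((q.out : SL(2, ℤ)) 1 1) *
        ∑' γ : Gamma1 l, stripFunction k g q.out ((q.out : SL(2, ℤ)) • (γ : SL(2, ℤ)) • τ) := by
    rw [← tsum_mul_right, ← tsum_mul_left]
    refine tsum_congr fun γ => ?_
    simp only [hB, Set.indicator, Set.mem_ofPred_eq, stripFunction, ← mul_smul]
    split_ifs
    · exact hg.denom_mul_phase q.out.2 γ.2 τ
    · simp
  rw [mul_assoc, mul_assoc, h4]

end Unfold

end TwistedModular

/-! ### Convergence and orthogonality. -/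

theorem mainTheorem4 (l : ℕ) (hl : 0 < l)
    (h : CuspForm ((Gamma0 l).map (Matrix.SpecialLinearGroup.mapGL ℝ)) 2)
    (k : ℤ) (hk : 3 ≤ k) (i : ℤ)
    (g : ℍ → ℂ) (hg : TwistedModular.IsTwistedCuspForm l h k g) :
    (∀ τ : ℍ, Summable fun p => ‖TwistedModular.eisensteinTerm l k i h τ p‖) ∧
    ∀ D : Set ℍ, TwistedModular.IsFundDomain (Gamma1 l) D →
      IntegrableOn
        (TwistedModular.peterssonIntegrand k (TwistedModular.eisenstein l k i h) g) D ∧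
      TwistedModular.peterssonInner D k (TwistedModular.eisenstein l k i h) g = 0 := by
  refine ⟨TwistedModular.summable_norm_eisensteinTerm l hk i h, fun D hD => ?_⟩
  have : NeZero l := ⟨hl.ne'⟩
  have := Fintype.ofFinite (Gamma0 l ⧸ (Gamma1 l).subgroupOf (Gamma0 l))
  have hq : ∀ q : Gamma0 l ⧸ (Gamma1 l).subgroupOf (Gamma0 l),
      IntegrableOn (fun τ => ∑' γ : Gamma1 l, TwistedModular.stripFunction k g q.out
        ((q.out : SL(2, ℤ)) • (γ : SL(2, ℤ)) • τ)) D ∧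
      ∫ τ in D, ∑' γ : Gamma1 l, TwistedModular.stripFunction k g q.out
        ((q.out : SL(2, ℤ)) • (γ : SL(2, ℤ)) • τ) = 0 := fun q => by
    have hs := hg.stripFunction_spec hk q.out.2
    -- The function to unfold is the strip function precomposed with the coset representative;
    -- invariance of the hyperbolic measure keeps it integrable with integral zero.
    have hmp := TwistedModular.measurePreserving_SL_smul q.out.1
    refine TwistedModular.integrableOn_tsum_smul_of_integral_eq_zero hD
      (hs.1.comp hmp.measurable) (hmp.integrable_comp_of_integrable hs.2.1) ?_
    have h1 := integral_map (μ := (volume : Measure ℍ)) hmp.measurable.aemeasurable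
      hs.1.aestronglyMeasurable
    rw [hmp.map_eq, hs.2.2] at h1
    exact h1.symm
  rw [TwistedModular.peterssonInner,
    funext (hg.peterssonIntegrand_eq hk i)]
  refine ⟨integrable_finsetSum _ fun q _ => (hq q).1.const_mul _, ?_⟩
  beta_reduce
  rw [integral_finsetSum _ fun q _ => (hq q).1.const_mul _]
  refine Finset.sum_eq_zero fun q _ => ?_
  rw [integral_const_mul]
  exact mul_eq_zero_of_right _ (hq q).2
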